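/- Let $H\in\{0,1\}^{m\times n}$ be a parity-check matrix and $\gamma\in\mathbb R^n$ a vector of log-likelihood ratios. For a check $j$ let $N(j)$ be the support of row $j$ of $H$; its parity inequalities are $\sum_{i\in V}u_i-\sum_{i\in N(j)\setminus V}u_i\le |V|-1$ with $V\subseteq N(j)$, $|V|$ odd. For a finite set $K$ of parity inequalities let $LP(K)$ be the problem of minimizing $\gamma^Tu$ subject to the inequalities in $K$, $u_i\ge0$ whenever $\gamma_i\ge0$, and $u_i\le1$ whenever $\gamma_i<0$. Modified adaptive LP (MALP) decoding starts with $K=\emptyset$. In each round, with $u$ the (unique) solution of the current $LP(K)$, every check $j$ that has no inequality in $K$ active at $u$ but has a parity inequality violated at $u$ has its inequalities in $K$ replaced by that violated one; in variant B (but not in variant A) the inequalities of all other checks without an inequality in $K$ active at $u$ are deleted too. If at least one inequality was added, the new problem is solved and the next round begins; otherwise decoding stops. Let $LP(K)$ be one of the problems solved by MALP decoding (variant A or B), where it and all preceding problems have unique solutions, let $u^*$ be its solution and $p=|K|$, $q=n+p$. Write it in the form $\min c^Tx$, $Ax=b$, $x\ge0$, by $x_i=u_i$ if $\gamma_i\ge0$,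 $x_i=1-u_i$ if $\gamma_i<0$ $(1\le i\le n)$ and one slack variable for each of the $p$ inequalities. The dual is: maximize $b^Ty$ subject to $A^Ty+z=c$, $z\ge0$. Let $x^*$ be the solution corresponding to $u^*$ and $\mathcal B=\{i: x^*_i>0\}$ the basic set. A set $\mathcal M$ of $p$ columns is triangular if $A_{\mathcal M}$ can be made triangular with nonzero diagonal by row and column permutations. For $x,z>0$ let $d_i=\sqrt{x_i/z_i}$ be the weight of column $i$, and $\mu=x^Tz/q$. Incremental greedy algorithm: go through the columns in order of decreasing weight, starting with $\mathcal M=\emptyset$, until $|\mathcal M|=p$ or all columns are used; add a column to $\mathcal M$ if the submatrix of the resulting set is triangulated by repeatedly selecting a row with exactly one nonzero entry and removing this row and the column of that entry, until all columns of the set are removed. Row-wise greedy algorithm: start with $\tilde A=A$, $\mathcal M=\emptyset$; while $\tilde A\ne0$, if some row of $\tilde A$ has exactly one nonzero entry, select such a row, add the column of that entry to $\mathcal M$ and set this column of $\tilde A$ to zero; otherwise set a nonzero column of $\tilde A$ of minimum weight to zero. Finally, for each row never selected, add its slack column to $\mathcal M$. Suppose that $u^*$ is integral. Then: (1) there is a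 dual optimal solution $(y^*,z^*)$ such that $(x^*,y^*,z^*)$ is strictly complementary, i.e. for every $i$ exactly one of $x_i^*,z_i^*$ is positive and the other is zero; (2) for every strictly complementary primal-dual optimal solution $(x^*,y^*,z^*)$ there is $\varepsilon>0$ such that, for every $(x,y,z)$ with $x,z>0$ at distance less than $\varepsilon$ from $(x^*,y^*,z^*)$ (feasible or not), both algorithms, run with the weights $d_i=\sqrt{x_i/z_i}$, terminate and output a triangular set $\mathcal M\supseteq\mathcal B$ together with orderings of the rows and of $\mathcal M$ that make $A_{\mathcal M}$ lower triangular, however ties and free choices are resolved; (3) for every $\theta>0$ there is $\varepsilon>0$ such that the same conclusion holds for every $(x,y,z)$ with $x,z>0$, $Ax=b$, $A^Ty+z=c$, $x_iz_i\ge\theta\mu$ for all $i$, and $\mu<\varepsilon$. In particular this applies to the iterates of an interior-point method that are sufficiently close to the optimum. -/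

import Mathlib

open scoped Matrix

noncomputable section

namespace LPDecoding

/-! ### Parity inequalities and the linear programs of adaptive LP decoding -/

/-- The neighbourhood of check node `j` in the Tanner graph of `H`. -/
def nbr {m n : ℕ} (H : Matrix (Fin m) (Fin n) (ZMod 2)) (j : Fin m) : Finset (Fin n) :=
  Finset.univ.filter fun i => H j i = 1

/-- A parity inequality is given by a check node `j` and a set `V`; it belongs to the Tanner graph
when `V` is an odd-sized subset of the neighbourhood of `j`. It reads
`∑ i ∈ V, u i - ∑ i ∈ N(j) \ V, u i ≤ |V| - 1`. -/
def IsParityIneq {m n : ℕ} (H : Matrix (Fin m) (Fin n) (ZMod 2)) (κ : Fin m × Finset (Fin n)) :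
    Prop :=
  κ.2 ⊆ nbr H κ.1 ∧ Odd κ.2.card

/-- Coefficient of `u i` in a parity inequality. -/
def coeff {m n : ℕ} (H : Matrix (Fin m) (Fin n) (ZMod 2)) (κ : Fin m × Finset (Fin n))
    (i : Fin n) : ℝ :=
  if i ∈ κ.2 then 1 else if i ∈ nbr H κ.1 then -1 else 0

/-- Right-hand side of a parity inequality. -/
def rhs {m n : ℕ} (κ : Fin m × Finset (Fin n)) : ℝ := (κ.2.card : ℝ) - 1

def IsActive {m n : ℕ} (H : Matrix (Fin m) (Fin n) (ZMod 2)) (κ : Fin m × Finset (Fin n))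
    (u : Fin n → ℝ) : Prop :=
  ∑ i, coeff H κ i * u i = rhs κ

def IsViolated {m n : ℕ} (H : Matrix (Fin m) (Fin n) (ZMod 2)) (κ : Fin m × Finset (Fin n))
    (u : Fin n → ℝ) : Prop :=
  rhs κ < ∑ i, coeff H κ i * u i

/-- Feasible points of the linear program with the parity inequalities in `K` and, for every
variable, the one box constraint selected by the sign of `γ i`. -/
def IsFeasible {m n : ℕ} (H : Matrix (Fin m) (Fin n) (ZMod 2)) (γ : Fin n → ℝ)
    (K : Finset (Fin m × Finset (Fin n))) (u : Fin n → ℝ) : Prop :=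
  (∀ κ ∈ K, ∑ i, coeff H κ i * u i ≤ rhs κ) ∧
    (∀ i, 0 ≤ γ i → 0 ≤ u i) ∧ (∀ i, γ i < 0 → u i ≤ 1)

/-- `u` minimizes `∑ i, γ i * u i` over the feasible points. -/
def IsSolution {m n : ℕ} (H : Matrix (Fin m) (Fin n) (ZMod 2)) (γ : Fin n → ℝ)
    (K : Finset (Fin m × Finset (Fin n))) (u : Fin n → ℝ) : Prop :=
  IsFeasible H γ K u ∧ ∀ v, IsFeasible H γ K v → ∑ i, γ i * u i ≤ ∑ i, γ i * v i

def IsUniqueSolution {m n : ℕ} (H : Matrix (Fin m) (Fin n) (ZMod 2)) (γ : Fin n → ℝ)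
    (K : Finset (Fin m × Finset (Fin n))) (u : Fin n → ℝ) : Prop :=
  IsSolution H γ K u ∧ ∀ v, IsSolution H γ K v → v = u

/-! ### Modified adaptive LP decoding -/

/-- The two variants of modified adaptive LP decoding. Variant `A` discards the old inequalities of
a check node only when it adds a new one; variant `B` discards all those of every check node
without an active inequality. -/
inductive Variant
  | A
  | B

/-- The current problem holds an inequality of check node `j` that is active at `u`. -/
def HasActive {m n : ℕ} (H : Matrix (Fin m) (Fin n) (ZMod 2))
    (K : Finset (Fin m × Finset (Fin n))) (u : Fin n → ℝ) (j : Fin m) : Prop :=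
  ∃ V, (j, V) ∈ K ∧ IsActive H (j, V) u

/-- `(j, V)` is a parity inequality of check node `j` that is violated at `u`. -/
def IsCut {m n : ℕ} (H : Matrix (Fin m) (Fin n) (ZMod 2)) (u : Fin n → ℝ) (j : Fin m)
    (V : Finset (Fin n)) : Prop :=
  IsParityIneq H (j, V) ∧ IsViolated H (j, V) u

/-- Check node `j` contributes a new inequality in the current round. -/
def AddsCut {m n : ℕ} (H : Matrix (Fin m) (Fin n) (ZMod 2))
    (K : Finset (Fin m × Finset (Fin n))) (u : Fin n → ℝ) (j : Fin m) : Prop :=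
  ¬ HasActive H K u j ∧ ∃ V, IsCut H u j V

/-- One round of modified adaptive LP decoding, from the inequalities `K` of the current program
with solution `u` to the inequalities `K'` of the next program that is solved. The first clause
says that at least one inequality has been added (otherwise decoding stops). -/
def Round {m n : ℕ} (var : Variant) (H : Matrix (Fin m) (Fin n) (ZMod 2))
    (K : Finset (Fin m × Finset (Fin n))) (u : Fin n → ℝ)
    (K' : Finset (Fin m × Finset (Fin n))) : Prop :=
  (∃ j, AddsCut H K u j) ∧
    ∀ j,
      (AddsCut H K u j → ∃ V, IsCut H u j V ∧ ∀ W, (j, W) ∈ K' ↔ W = V) ∧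
      (¬ AddsCut H K u j →
        ∀ W, (j, W) ∈ K' ↔ (j, W) ∈ K ∧ (var = Variant.A ∨ HasActive H K u j))

/-- `IsSubproblem var H γ K`: the program with parity inequalities `K` is one of the programs
`LP⁰, LP¹, …` solved by modified adaptive LP decoding of `γ`, all earlier programs having unique
solutions. -/
inductive IsSubproblem {m n : ℕ} (var : Variant) (H : Matrix (Fin m) (Fin n) (ZMod 2))
    (γ : Fin n → ℝ) : Finset (Fin m × Finset (Fin n)) → Prop
  | init : IsSubproblem var H γ ∅
  | round {K K' : Finset (Fin m × Finset (Fin n))} {u : Fin n → ℝ} :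
      IsSubproblem var H γ K → IsUniqueSolution H γ K u → Round var H K u K' →
      IsSubproblem var H γ K'

/-! ### The augmented form `min cᵀx, A x = b, x ≥ 0` -/

/-- The standard variable `x i` is `u i` if `γ i ≥ 0` and `1 - u i` if `γ i < 0`; the sign records
the resulting change of coefficients. -/
def sgn {n : ℕ} (γ : Fin n → ℝ) (i : Fin n) : ℝ := if 0 ≤ γ i then 1 else -1

/-- Augmented constraint matrix. Its rows are the inequalities in `K`; its columns are the
standard variables `Sum.inl i` and the slack variables `Sum.inr κ`. -/
def augA {m n : ℕ} (H : Matrix (Fin m) (Fin n) (ZMod 2)) (γ : Fin n → ℝ)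
    (K : Finset (Fin m × Finset (Fin n))) : Matrix K (Fin n ⊕ K) ℝ :=
  Matrix.fromCols (Matrix.of fun κ i => sgn γ i * coeff H κ.1 i) 1

def augb {m n : ℕ} (H : Matrix (Fin m) (Fin n) (ZMod 2)) (γ : Fin n → ℝ)
    (K : Finset (Fin m × Finset (Fin n))) : K → ℝ :=
  fun κ => rhs κ.1 - ∑ i, if 0 ≤ γ i then 0 else coeff H κ.1 i

def augc {m n : ℕ} (γ : Fin n → ℝ) (K : Finset (Fin m × Finset (Fin n))) : Fin n ⊕ K → ℝ :=
  Sum.elim (fun i => sgn γ i * γ i) (fun _ => 0)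

/-- The point of the augmented program that corresponds to `u`. -/
def augx {m n : ℕ} (H : Matrix (Fin m) (Fin n) (ZMod 2)) (γ : Fin n → ℝ)
    (K : Finset (Fin m × Finset (Fin n))) (u : Fin n → ℝ) : Fin n ⊕ K → ℝ :=
  Sum.elim (fun i => if 0 ≤ γ i then u i else 1 - u i)
    (fun κ => rhs κ.1 - ∑ i, coeff H κ.1 i * u i)

/-! ### Primal-dual solutions and interior points -/

def IsPrimalFeasible {R C : Type} [Fintype C] (A : Matrix R C ℝ) (b : R → ℝ) (x : C → ℝ) : Prop :=
  A *ᵥ x = b ∧ ∀ i, 0 ≤ x i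

def IsDualFeasible {R C : Type} [Fintype R] (A : Matrix R C ℝ) (c : C → ℝ) (y : R → ℝ)
    (z : C → ℝ) : Prop :=
  Aᵀ *ᵥ y + z = c ∧ ∀ i, 0 ≤ z i

/-- `x` is an optimal solution of the primal program (minimize `cᵀx`) and `(y, z)` one of the dual
program (maximize `bᵀy`). -/
def IsPrimalDualSolution {R C : Type} [Fintype R] [Fintype C] (A : Matrix R C ℝ) (b : R → ℝ)
    (c : C → ℝ) (x : C → ℝ) (y : R → ℝ) (z : C → ℝ) : Prop :=
  (IsPrimalFeasible A b x ∧ ∀ x', IsPrimalFeasible A b x' → c ⬝ᵥ x ≤ c ⬝ᵥ x') ∧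
    (IsDualFeasible A c y z ∧ ∀ y' z', IsDualFeasible A c y' z' → b ⬝ᵥ y' ≤ b ⬝ᵥ y)

def StrictlyComplementary {C : Type} (x z : C → ℝ) : Prop :=
  ∀ i, (x i = 0 ∧ 0 < z i) ∨ (0 < x i ∧ z i = 0)

/-- Positivity of `x` and `z`, which every iterate of a primal-dual interior-point method has. -/
def IsInterior {C : Type} (x z : C → ℝ) : Prop := (∀ i, 0 < x i) ∧ ∀ i, 0 < z i

/-- The duality measure `μ = xᵀz / q`. -/
def dualityMeasure {C : Type} [Fintype C] (x z : C → ℝ) : ℝ := (x ⬝ᵥ z) / Fintype.card C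

/-- The column weights `d i = √(x i / z i)`. -/
def weight {C : Type} (x z : C → ℝ) (i : C) : ℝ := Real.sqrt (x i / z i)

/-- The basic set of a solution `x`. -/
def basicSet {C : Type} (x : C → ℝ) : Set C := {i | 0 < x i}

/-! ### Triangular sets -/

/-- `M` consists of `p` columns, `p` the number of rows, and `A_M` can be made lower or upper
triangular with nonzero diagonal by permuting its rows and columns. -/
def IsTriangularSet {R C : Type} [Fintype R] (A : Matrix R C ℝ) (M : Finset C) : Prop :=
  ∃ (r : Fin (Fintype.card R) ≃ R) (c : Fin (Fintype.card R) ≃ M),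
    (∀ k, A (r k) (c k) ≠ 0) ∧
      ((∀ k l, k < l → A (r k) (c l) = 0) ∨ (∀ k l, l < k → A (r k) (c l) = 0))

/-- The lists `row` and `col` enumerate all rows of `A` and the columns in `M` in an order that
makes `A_M` lower triangular with nonzero diagonal. -/
def IsLowerTriangularForm {R C : Type} (A : Matrix R C ℝ) (M : Finset C) (col : List C)
    (row : List R) : Prop :=
  row.Nodup ∧ (∀ j, j ∈ row) ∧ col.Nodup ∧ (∀ i, i ∈ col ↔ i ∈ M) ∧ col.length = row.length ∧
    ∀ (k l : ℕ) (hk : k < row.length) (hl : l < col.length),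
      (k < l → A row[k] col[l] = 0) ∧ (k = l → A row[k] col[l] ≠ 0)

/-- Row `j` of `B` has degree one, its only nonzero entry being in column `i`. -/
def IsDegreeOne {R C : Type} (B : Matrix R C ℝ) (j : R) (i : C) : Prop :=
  ∀ i', B j i' ≠ 0 ↔ i' = i

/-! ### Nondeterministic algorithms -/

/-- Total correctness of a nondeterministic program given by its one-step relation: every execution
from `init` terminates, and every state in which an execution ends satisfies `post`. -/
def TotallyCorrect {σ : Type} (step : σ → σ → Prop) (init : σ) (post : σ → Prop) : Prop :=
  Acc (fun t s => step s t) init ∧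
    ∀ s, Relation.ReflTransGen step init s → (∀ t, ¬ step s t) → post s

/-! ### The triangulation step -/

structure TriState (R C : Type) where
  mat : Matrix R C ℝ
  col : List C
  row : List R

/-- `A_S`, the columns outside `S` being kept as zero columns. -/
def restrictCols {R C : Type} [DecidableEq C] (A : Matrix R C ℝ) (S : Finset C) : Matrix R C ℝ :=
  Matrix.of fun j i => if i ∈ S then A j i else 0

/-- One pass through the loop `for k = 1 to s`: select any degree-one row, record it and its
column, and set both to zero. -/
inductive TriStep {R C : Type} [DecidableEq R] [DecidableEq C] (s : ℕ) :
    TriState R C → TriState R C → Prop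
  | select (st : TriState R C) (j : R) (i : C) :
      st.col.length < s → IsDegreeOne st.mat j i →
      TriStep s st ⟨(st.mat.updateCol i 0).updateRow j 0, st.col ++ [i], st.row ++ [j]⟩

def TriReach {R C : Type} [DecidableEq R] [DecidableEq C] (A : Matrix R C ℝ) (S : Finset C)
    (st : TriState R C) : Prop :=
  Relation.ReflTransGen (TriStep S.card) ⟨restrictCols A S, [], []⟩ st

/-- The triangulation step, run on `S`, can succeed with output `col`, `row`. -/
def TriSucceeds {R C : Type} [DecidableEq R] [DecidableEq C] (A : Matrix R C ℝ) (S : Finset C)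
    (col : List C) (row : List R) : Prop :=
  ∃ B, TriReach A S ⟨B, col, row⟩ ∧ col.length = S.card

/-- The triangulation step, run on `S`, can run out of degree-one rows and declare failure. -/
def TriFails {R C : Type} [DecidableEq R] [DecidableEq C] (A : Matrix R C ℝ) (S : Finset C) :
    Prop :=
  ∃ st, TriReach A S st ∧ st.col.length < S.card ∧ ∀ j i, ¬ IsDegreeOne st.mat j i

/-! ### The incremental greedy search -/

structure IncState (R C : Type) where
  idx : ℕ
  M : Finset C
  col : List C
  row : List R

/-- One pass through the while-loop, `π` being the sorted sequence of columns. -/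
inductive IncStep {R C : Type} [Fintype R] [Fintype C] [DecidableEq R] [DecidableEq C]
    (A : Matrix R C ℝ) (π : Fin (Fintype.card C) ≃ C) : IncState R C → IncState R C → Prop
  | accept (st : IncState R C) (h : st.idx < Fintype.card C) (col : List C) (row : List R) :
      st.M.card < Fintype.card R → TriSucceeds A (insert (π ⟨st.idx, h⟩) st.M) col row →
      IncStep A π st ⟨st.idx + 1, insert (π ⟨st.idx, h⟩) st.M, col, row⟩
  | reject (st : IncState R C) (h : st.idx < Fintype.card C) :
      st.M.card < Fintype.card R → TriFails A (insert (π ⟨st.idx, h⟩) st.M) →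
      IncStep A π st ⟨st.idx + 1, st.M, st.col, st.row⟩

/-- For weights `d`, and however ties in sorting and choices of degree-one rows are resolved, the
incremental greedy search terminates with a triangular set that contains `B`. -/
def IncrementalFinds {R C : Type} [Fintype R] [Fintype C] [DecidableEq R] [DecidableEq C]
    (A : Matrix R C ℝ) (d : C → ℝ) (B : Set C) : Prop :=
  ∀ π : Fin (Fintype.card C) ≃ C, Antitone (fun k => d (π k)) →
    TotallyCorrect (IncStep A π) ⟨0, ∅, [], []⟩ fun st =>
      IsTriangularSet A st.M ∧ IsLowerTriangularForm A st.M st.col st.row ∧ B ⊆ ↑st.M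

/-! ### The row-wise greedy search -/

structure RowState (R C : Type) where
  mat : Matrix R C ℝ
  M : Finset C
  col : List C
  row : List R

/-- One step of the row-wise greedy search. While the residual matrix is nonzero, either any
degree-one row is selected or, if there is none, a nonzero column of minimum weight is erased.
Once it is zero, the rows that are not represented yet are appended with their slack columns. -/
inductive RowStep {R C : Type} [DecidableEq C] (slack : R → C) (d : C → ℝ) :
    RowState R C → RowState R C → Prop
  | select (st : RowState R C) (j : R) (i : C) :
      IsDegreeOne st.mat j i →
      RowStep slack d st ⟨st.mat.updateCol i 0, insert i st.M, st.col ++ [i], st.row ++ [j]⟩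
  | erase (st : RowState R C) (i : C) :
      (∀ j i', ¬ IsDegreeOne st.mat j i') → (∃ j, st.mat j i ≠ 0) →
      (∀ i', (∃ j, st.mat j i' ≠ 0) → d i ≤ d i') →
      RowStep slack d st ⟨st.mat.updateCol i 0, st.M, st.col, st.row⟩
  | expand (st : RowState R C) (j : R) :
      st.mat = 0 → j ∉ st.row →
      RowStep slack d st ⟨st.mat, insert (slack j) st.M, st.col ++ [slack j], st.row ++ [j]⟩

/-- For weights `d`, and however ties and choices of degree-one rows are resolved, the row-wise
greedy search terminates with a triangular set that contains `B`. -/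
def RowWiseFinds {R C : Type} [Fintype R] [DecidableEq C] (A : Matrix R C ℝ)
    (slack : R → C) (d : C → ℝ) (B : Set C) : Prop :=
  TotallyCorrect (RowStep slack d) ⟨A, ∅, [], []⟩ fun st =>
    IsTriangularSet A st.M ∧ IsLowerTriangularForm A st.M st.col st.row ∧ B ⊆ ↑st.M

/-- Both greedy searches, run on the augmented constraint matrix with the weights of the interior
point `(x, z)`, find a triangular set containing the basic columns of the solution `u`. -/
def BothGreedyFind {m n : ℕ} (H : Matrix (Fin m) (Fin n) (ZMod 2)) (γ : Fin n → ℝ)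
    (K : Finset (Fin m × Finset (Fin n))) (u : Fin n → ℝ) (x z : Fin n ⊕ K → ℝ) : Prop :=
  IncrementalFinds (augA H γ K) (weight x z) (basicSet (augx H γ K u)) ∧
    RowWiseFinds (augA H γ K) Sum.inr (weight x z) (basicSet (augx H γ K u))

end LPDecoding

end

/-! Three facts combine.

The basic set is `Peelable`. A parity row says that the point has l1 distance at least 1, over the
support of the row, from one forbidden 0-1 vector, and the slack is this distance minus 1
(`IsParityType.sum_eq`). Uniqueness forces the optimum into the unit box (`IsUniqueOptimum.le_one`),
so by integrality every positive non-slack variable equals 1. Lowering a nonempty set `T` of such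
variables together never raises the cost, so by uniqueness it must violate an active row. At
distance 1 an active row has at most one coefficient -1 on `T`, and a single +1 on `T` would
compensate it; so the violated row has exactly one nonzero entry on `T`. Its slack is zero, hence
not basic, and slack columns do not interfere (`IsUniqueOptimum.peelable_basicSet`).

Peeling a set all of whose nonempty subsets have a degree-one row can never get stuck, whatever
choices are made. So if every basic column outweighs every other column, the incremental search
meets the basic columns first and accepts them all, and the row-wise search never erases one; the
identity block of slack columns completes the set (`incrementalFinds_of_separated`,
`rowWiseFinds_of_separated`).

Weights do separate near the optimum. A unique optimum has a strictly complementary dual partner by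
convex separation (`IsUniqueOptimum.exists_strictlyComplementary`). Separation means `x k * z i < x
i * z k` for basic `i` and nonbasic `k`: an open condition that holds at the limit, with a
quantitative version on centred feasible points (`exists_separated_of_dualityMeasure_lt`). -/

namespace LPDecoding

/-! ### Peelable sets of columns -/

section Peeling

variable {R C : Type}

/-- Every nonempty finite set of columns in `S` has a row of degree one. -/
def Peelable [DecidableEq C] (A : Matrix R C ℝ) (S : Set C) : Prop :=
  ∀ T : Finset C, T.Nonempty → ↑T ⊆ S → ∃ j i, IsDegreeOne (restrictCols A T) j i

theorem Peelable.mono [DecidableEq C] {A : Matrix R C ℝ} {S S' : Set C} (h : Peelable A S')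
    (hS : S ⊆ S') : Peelable A S :=
  fun T hT hTS => h T hT (hTS.trans hS)

theorem isDegreeOne_restrictCols [DecidableEq C] {A : Matrix R C ℝ} {T : Finset C} {j : R} {i : C} :
    IsDegreeOne (restrictCols A T) j i ↔ i ∈ T ∧ A j i ≠ 0 ∧ ∀ i' ∈ T, i' ≠ i → A j i' = 0 := by
  constructor
  · intro h
    have hi := (h i).2 rfl
    simp only [restrictCols, Matrix.of_apply, ne_eq, ite_eq_right_iff, not_forall] at hi
    obtain ⟨hiT, hAi⟩ := hi
    refine ⟨hiT, hAi, fun i' hi' hne => ?_⟩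
    by_contra h0
    exact hne ((h i').1 (by simpa [restrictCols, hi'] using h0))
  · rintro ⟨hiT, hAi, h0⟩ i'
    constructor
    · intro h
      by_contra hne
      simp only [restrictCols, Matrix.of_apply, ne_eq, ite_eq_right_iff, not_forall] at h
      obtain ⟨hi', hA⟩ := h
      exact hA (h0 i' hi' hne)
    · rintro rfl
      simpa [restrictCols, hiT] using hAi

theorem updateCol_restrictCols [DecidableEq C] (A : Matrix R C ℝ) (T : Finset C) (i : C) :
    (restrictCols A T).updateCol i 0 = restrictCols A (T.erase i) := by
  ext j i'
  by_cases h : i' = i <;> simp [restrictCols, h]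

/-- `col` enumerates `M`, and pairs its columns with the distinct rows in `row` in a way that makes
the corresponding square submatrix lower triangular with nonzero diagonal. -/
structure IsPartialForm (A : Matrix R C ℝ) (M : Finset C) (col : List C) (row : List R) :
    Prop where
  row_nodup : row.Nodup
  col_nodup : col.Nodup
  mem_col : ∀ i, i ∈ col ↔ i ∈ M
  length_eq : col.length = row.length
  entry : ∀ (k l : ℕ) (hk : k < row.length) (hl : l < col.length),
    (k < l → A row[k] col[l] = 0) ∧ (k = l → A row[k] col[l] ≠ 0)

namespace IsPartialForm

theorem nil (A : Matrix R C ℝ) : IsPartialForm A ∅ [] [] :=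
  ⟨List.nodup_nil, List.nodup_nil, by simp, rfl, by simp⟩

variable {A : Matrix R C ℝ} {M : Finset C} {col : List C} {row : List R}

theorem append [DecidableEq C] (h : IsPartialForm A M col row) {j : R} {i : C} (hj : j ∉ row)
    (hi : i ∉ M) (h0 : ∀ j' ∈ row, A j' i = 0) (hne : A j i ≠ 0) :
    IsPartialForm A (insert i M) (col ++ [i]) (row ++ [j]) where
  row_nodup := by
    rw [List.nodup_append]
    exact ⟨h.row_nodup, List.nodup_singleton j, by grind⟩
  col_nodup := by
    rw [List.nodup_append]
    have := h.mem_col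
    exact ⟨h.col_nodup, List.nodup_singleton i, by grind⟩
  mem_col := by
    intro i'
    have := h.mem_col i'
    simp [this, or_comm]
  length_eq := by simp [h.length_eq]
  entry := by
    intro k l hk hl
    have hlen := h.length_eq
    simp only [List.length_append, List.length_singleton] at hk hl
    by_cases hl' : l < col.length
    · by_cases hk' : k < row.length
      · simpa [List.getElem_append, hl', hk'] using h.entry k l hk' hl'
      · constructor <;> intro <;> omega
    · by_cases hk' : k < row.length
      · refine ⟨fun _ => ?_, fun _ => by omega⟩
        simpa [List.getElem_append, hl', hk'] using h0 _ (List.getElem_mem hk')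
      · refine ⟨fun _ => by omega, fun _ => ?_⟩
        simpa [List.getElem_append, hl', hk'] using hne

theorem card_eq (h : IsPartialForm A M col row) : M.card = row.length := by
  classical
  rw [← h.length_eq, ← List.toFinset_card_of_nodup h.col_nodup]
  congr 1
  ext i
  simp [h.mem_col]

theorem card_le [Fintype R] (h : IsPartialForm A M col row) : M.card ≤ Fintype.card R :=
  h.card_eq ▸ h.row_nodup.length_le_card

theorem exists_row (h : IsPartialForm A M col row) {i : C} (hi : i ∈ M) :
    ∃ j ∈ row, A j i ≠ 0 := by
  obtain ⟨k, hk, rfl⟩ := List.getElem_of_mem ((h.mem_col i).2 hi)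
  have hk' : k < row.length := h.length_eq ▸ hk
  exact ⟨row[k], List.getElem_mem hk', (h.entry k k hk' hk).2 rfl⟩

/-- Take the column of `T` that comes first in `col`: in its partner row all later columns vanish,
hence all the rest of `T`. -/
theorem exists_isDegreeOne [DecidableEq C] (h : IsPartialForm A M col row) {T : Finset C}
    (hT : T.Nonempty) (hTM : T ⊆ M) : ∃ j ∈ row, ∃ i, IsDegreeOne (restrictCols A T) j i := by
  have hex : ∃ k, ∃ hk : k < col.length, col[k] ∈ T := by
    obtain ⟨i, hi⟩ := hT
    obtain ⟨k, hk, rfl⟩ := List.getElem_of_mem ((h.mem_col i).2 (hTM hi))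
    exact ⟨k, hk, hi⟩
  classical
  obtain ⟨hk, hkT⟩ := Nat.find_spec hex
  set k := Nat.find hex with hkdef
  have hk' : k < row.length := h.length_eq ▸ hk
  refine ⟨row[k], List.getElem_mem hk', col[k], isDegreeOne_restrictCols.2
    ⟨hkT, (h.entry k k hk' hk).2 rfl, fun i' hi' hne => ?_⟩⟩
  obtain ⟨l, hl, rfl⟩ := List.getElem_of_mem ((h.mem_col i').2 (hTM hi'))
  have hkl : k ≤ l := Nat.find_min' hex ⟨hl, hi'⟩
  refine (h.entry k l hk' hl).1 (lt_of_le_of_ne hkl ?_)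
  rintro rfl
  exact hne rfl

theorem peelable [DecidableEq C] (h : IsPartialForm A M col row) : Peelable A (M : Set C) := by
  intro T hT hTM
  obtain ⟨j, -, i, hji⟩ := h.exists_isDegreeOne hT (by exact_mod_cast hTM)
  exact ⟨j, i, hji⟩

theorem slack_notMem {slack : R → C} (hslack : ∀ j k, A j (slack k) ≠ 0 ↔ j = k)
    (h : IsPartialForm A M col row) {j : R} (hj : j ∉ row) : slack j ∉ M := by
  intro hM
  obtain ⟨j', hj', hne⟩ := h.exists_row hM
  exact hj ((hslack j' j).1 hne ▸ hj')

/-- The slack column of an unmatched row is zero in all matched rows, so it fits at the end of the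
triangular form. This is why a maximal set must match every row. -/
theorem peelable_insert_slack [DecidableEq C] {slack : R → C}
    (hslack : ∀ j k, A j (slack k) ≠ 0 ↔ j = k)
    (h : IsPartialForm A M col row) {j : R} (hj : j ∉ row) :
    Peelable A (↑(insert (slack j) M) : Set C) :=
  (h.append hj (h.slack_notMem hslack hj)
    (fun j' hj' => by
      by_contra hne
      exact hj ((hslack j' j).1 hne ▸ hj'))
    ((hslack j j).2 rfl)).peelable

theorem isLowerTriangularForm (h : IsPartialForm A M col row) (hrow : ∀ j, j ∈ row) :
    IsLowerTriangularForm A M col row :=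
  ⟨h.row_nodup, hrow, h.col_nodup, h.mem_col, h.length_eq, h.entry⟩

theorem isTriangularSet [Fintype R] (h : IsPartialForm A M col row) (hrow : ∀ j, j ∈ row) :
    IsTriangularSet A M := by
  classical
  have hlen : row.length = Fintype.card R := by
    rw [← List.toFinset_card_of_nodup h.row_nodup]
    exact Finset.card_eq_iff_eq_univ _ |>.2 (by ext; simp [hrow])
  have hlen' : col.length = Fintype.card R := h.length_eq.trans hlen
  let r : Fin (Fintype.card R) ≃ R :=
    (finCongr hlen.symm).trans (List.Nodup.getEquivOfForallMemList row h.row_nodup hrow)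
  let c : Fin (Fintype.card R) ≃ M :=
    ((finCongr hlen'.symm).trans (List.Nodup.getEquiv col h.col_nodup)).trans
      (Equiv.subtypeEquivRight h.mem_col)
  have hr : ∀ k, r k = row[k.1]'(by omega) := fun k => rfl
  have hc : ∀ k, (c k : C) = col[k.1]'(by omega) := fun k => rfl
  refine ⟨r, c, fun k => ?_, Or.inl fun k l hkl => ?_⟩
  · rw [hr, hc]
    exact (h.entry k k (by omega) (by omega)).2 rfl
  · rw [hr, hc]
    exact (h.entry k l (by omega) (by omega)).1 hkl

theorem mem_row_of_card_eq [Fintype R] (h : IsPartialForm A M col row)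
    (hcard : M.card = Fintype.card R) (j : R) : j ∈ row := by
  classical
  have : row.toFinset = Finset.univ := by
    rw [← Finset.card_eq_iff_eq_univ, List.toFinset_card_of_nodup h.row_nodup, ← h.card_eq, hcard]
  simpa using this.ge (Finset.mem_univ j)

end IsPartialForm

/-- The columns `T` that remain in the residual matrix vanish in the rows selected so far, and the
columns removed in favour of these rows form `M`. -/
structure IsPeeling (A : Matrix R C ℝ) (T M : Finset C) (col : List C) (row : List R) : Prop where
  form : IsPartialForm A M col row
  notMem : ∀ i ∈ T, i ∉ M
  entry_eq_zero : ∀ j ∈ row, ∀ i ∈ T, A j i = 0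

/-- Earlier selected rows vanish on `T`. Hence `j`, which does not vanish at `i ∈ T`, is a new row,
and column `i` has zeros above its diagonal entry. -/
theorem IsPeeling.select [DecidableEq C] {A : Matrix R C ℝ} {T M : Finset C} {col : List C}
    {row : List R} (h : IsPeeling A T M col row) {j : R} {i : C}
    (hji : IsDegreeOne (restrictCols A T) j i) :
    IsPeeling A (T.erase i) (insert i M) (col ++ [i]) (row ++ [j]) := by
  obtain ⟨hi, hne, h0⟩ := isDegreeOne_restrictCols.1 hji
  refine ⟨h.form.append (fun hj => hne (h.entry_eq_zero j hj i hi)) (h.notMem i hi)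
    (fun j' hj' => h.entry_eq_zero j' hj' i hi) hne, ?_, ?_⟩
  · intro i' hi'
    have := h.notMem i' (Finset.mem_of_mem_erase hi')
    simp [this, Finset.ne_of_mem_erase hi']
  · intro j' hj' i' hi'
    rcases List.mem_append.1 hj' with hj' | hj'
    · exact h.entry_eq_zero j' hj' i' (Finset.mem_of_mem_erase hi')
    · rw [List.mem_singleton.1 hj']
      exact h0 i' (Finset.mem_of_mem_erase hi') (Finset.ne_of_mem_erase hi')

end Peeling

/-! ### Correctness of the triangulation step -/

section Triangulation

variable {R C : Type} [DecidableEq R] [DecidableEq C] {A : Matrix R C ℝ} {S : Finset C}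

/-- Zeroing the selected row is redundant: it had degree one, so it already vanishes once its column
is removed. Every reachable matrix is thus a column restriction of `A`. -/
theorem TriReach.isPeeling {st : TriState R C} (h : TriReach A S st) :
    ∃ M ⊆ S, st.mat = restrictCols A (S \ M) ∧ IsPeeling A (S \ M) M st.col st.row := by
  induction h with
  | refl => exact ⟨∅, by simp, by simp, ⟨.nil A, by simp, by simp⟩⟩
  | tail _ hstep ih =>
    obtain ⟨M, hMS, hmat, hp⟩ := ih
    cases hstep with
    | select j i hlt hdeg =>
      rw [hmat] at hdeg
      obtain ⟨hi, hne, h0⟩ := isDegreeOne_restrictCols.1 hdeg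
      have hsd : S \ insert i M = (S \ M).erase i := by
        ext; simp only [Finset.mem_sdiff, Finset.mem_insert, Finset.mem_erase]; tauto
      refine ⟨insert i M, Finset.insert_subset (Finset.mem_sdiff.1 hi).1 hMS, ?_, ?_⟩
      · simp only [hsd, hmat, updateCol_restrictCols]
        ext j' i'
        by_cases hj : j' = j
        · subst hj
          by_cases hi' : i' ∈ (S \ M).erase i
          · simp [restrictCols, h0 i' (Finset.mem_of_mem_erase hi') (Finset.ne_of_mem_erase hi')]
          · rw [Matrix.updateRow_self]
            exact (if_neg hi').symm
        · simp [hj]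
      · rw [hsd]
        exact hp.select hdeg

theorem TriSucceeds.isPartialForm {col : List C} {row : List R} (h : TriSucceeds A S col row) :
    IsPartialForm A S col row := by
  obtain ⟨B, hB, hlen⟩ := h
  obtain ⟨M, hMS, -, hp⟩ := hB.isPeeling
  have : M = S := Finset.eq_of_subset_of_card_le hMS (by
    rw [hp.form.card_eq, ← hp.form.length_eq]; exact hlen.ge)
  exact this ▸ hp.form

/-- A failed run leaves a nonempty column set without a degree-one row. So on a peelable set no
order of selection can fail. -/
theorem TriFails.not_peelable (h : TriFails A S) : ¬ Peelable A (S : Set C) := by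
  obtain ⟨st, hst, hlt, hdeg⟩ := h
  obtain ⟨M, hMS, hmat, hp⟩ := hst.isPeeling
  intro hpeel
  have hne : (S \ M).Nonempty := by
    rw [Finset.sdiff_nonempty]
    intro hSM
    have := Finset.card_le_card hSM
    rw [hp.form.card_eq, ← hp.form.length_eq] at this
    omega
  obtain ⟨j, i, hji⟩ := hpeel _ hne (by exact_mod_cast Finset.sdiff_subset)
  exact hdeg j i (hmat ▸ hji)

variable (A S) in
theorem triSucceeds_or_triFails : (∃ col row, TriSucceeds A S col row) ∨ TriFails A S := by
  have key : ∀ (k : ℕ) (st : TriState R C), TriReach A S st → st.col.length ≤ S.card →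
      S.card - st.col.length = k → (∃ col row, TriSucceeds A S col row) ∨ TriFails A S := by
    intro k
    induction k with
    | zero =>
      intro st hst hle hk
      exact Or.inl ⟨st.col, st.row, st.mat, hst, by omega⟩
    | succ k ih =>
      intro st hst hle hk
      by_cases hdeg : ∃ j i, IsDegreeOne st.mat j i
      · obtain ⟨j, i, hji⟩ := hdeg
        refine ih _ (hst.tail (.select st j i (by omega) hji)) ?_ ?_ <;>
          simp only [List.length_append, List.length_singleton] <;> omega
      · push Not at hdeg
        exact Or.inr ⟨st, hst, by omega, hdeg⟩
  exact key _ _ .refl (by simp) rfl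

theorem Peelable.exists_isPartialForm (h : Peelable A (S : Set C)) :
    ∃ col row, IsPartialForm A S col row := by
  obtain ⟨col, row, hs⟩ | hf := triSucceeds_or_triFails A S
  · exact ⟨col, row, hs.isPartialForm⟩
  · exact absurd h hf.not_peelable

theorem Peelable.card_le [Fintype R] (h : Peelable A (S : Set C)) :
    S.card ≤ Fintype.card R :=
  let ⟨_, _, hf⟩ := h.exists_isPartialForm
  hf.card_le

end Triangulation

/-! ### The incremental greedy search -/

theorem mem_basic_of_le {C : Type} [Fintype C] {d : C → ℝ} {B : Set C}
    {π : Fin (Fintype.card C) ≃ C} (hd : ∀ i ∈ B, ∀ k ∉ B, d k < d i)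
    (hπ : Antitone fun k => d (π k)) {i i' : C} (hi : i ∈ B)
    (hle : π.symm i' ≤ π.symm i) : i' ∈ B := by
  by_contra hi'
  have := hπ hle
  simp only [Equiv.apply_symm_apply] at this
  exact absurd (hd i hi i' hi') this.not_gt

section Incremental

variable {R C : Type} [Fintype R] [Fintype C] [DecidableEq R] [DecidableEq C]

/-- The state of the incremental greedy search after the columns before `st.idx`: those in `B` have
been accepted, and no rejected column can be added. -/
structure IncState.IsValid (A : Matrix R C ℝ) (π : Fin (Fintype.card C) ≃ C) (B : Set C)
    (st : IncState R C) : Prop where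
  form : IsPartialForm A st.M st.col st.row
  lt_idx : ∀ i ∈ st.M, (π.symm i : ℕ) < st.idx
  mem_of_basic : ∀ i ∈ B, (π.symm i : ℕ) < st.idx → i ∈ st.M
  maximal : ∀ i ∉ st.M, (π.symm i : ℕ) < st.idx → ¬ Peelable A (↑(insert i st.M) : Set C)

variable {A : Matrix R C ℝ} {d : C → ℝ} {B : Set C} {π : Fin (Fintype.card C) ≃ C}

theorem IncState.IsValid.step (hB : Peelable A B) (hd : ∀ i ∈ B, ∀ k ∉ B, d k < d i)
    (hπ : Antitone fun k => d (π k)) {st st' : IncState R C} (hst : st.IsValid A π B)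
    (hstep : IncStep A π st st') : st'.IsValid A π B := by
  have hlast : ∀ (h : st.idx < Fintype.card C) (i : C), (π.symm i : ℕ) < st.idx + 1 →
      (π.symm i : ℕ) < st.idx ∨ i = π ⟨st.idx, h⟩ := by
    intro h i hi
    rcases Nat.lt_succ_iff_lt_or_eq.1 hi with hlt | heq
    · exact Or.inl hlt
    · exact Or.inr ((Equiv.symm_apply_eq π).1 (Fin.ext heq))
  cases hstep with
  | accept h col row hcard hs =>
    refine ⟨hs.isPartialForm, ?_, ?_, ?_⟩
    · intro i hi
      rcases Finset.mem_insert.1 hi with rfl | hi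
      · simp
      · exact Nat.lt_succ_of_lt (hst.lt_idx i hi)
    · intro i hi hlt
      rcases hlast h i hlt with hlt | rfl
      · exact Finset.mem_insert_of_mem (hst.mem_of_basic i hi hlt)
      · exact Finset.mem_insert_self _ _
    · intro i hi hlt hp
      rcases hlast h i hlt with hlt | rfl
      · refine hst.maximal i (fun hM => hi (Finset.mem_insert_of_mem hM)) hlt (hp.mono ?_)
        exact_mod_cast Finset.insert_subset_insert i (Finset.subset_insert _ _)
      · exact hi (Finset.mem_insert_self _ _)
  | reject h hcard hf =>
    refine ⟨hst.form, fun i hi => Nat.lt_succ_of_lt (hst.lt_idx i hi), ?_, ?_⟩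
    · intro i hi hlt
      rcases hlast h i hlt with hlt | rfl
      · exact hst.mem_of_basic i hi hlt
      · refine absurd (hB.mono ?_) hf.not_peelable
        intro i' hi'
        rcases Finset.mem_insert.1 (Finset.mem_coe.1 hi') with rfl | hi'
        · exact hi
        · refine mem_basic_of_le hd hπ hi ?_
          rw [Equiv.symm_apply_apply]
          exact (hst.lt_idx i' hi').le
    · intro i hi hlt
      rcases hlast h i hlt with hlt | rfl
      · exact hst.maximal i hi hlt
      · exact hf.not_peelable

/-- If the search ended with fewer columns than rows, all columns would have been tried, and the
slack column of an unmatched row would have been wrongly rejected. If a column `b ∈ B` were missing,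
it would not have been reached; then `st.M` and `b` together would lie in `B`, a peelable set with
more columns than there are rows. -/
theorem incrementalFinds_of_separated {slack : R → C} (hslack : ∀ j k, A j (slack k) ≠ 0 ↔ j = k)
    (hB : Peelable A B) (hd : ∀ i ∈ B, ∀ k ∉ B, d k < d i) : IncrementalFinds A d B := by
  intro π hπ
  constructor
  · refine Subrelation.accessible (r := InvImage (· < ·)
      fun st : IncState R C => Fintype.card C - st.idx) ?_
      ((InvImage.wf _ wellFounded_lt).apply _)
    intro t s hst
    cases hst <;> simp only [InvImage] <;> omega
  · intro st hreach hfinal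
    have hst : st.IsValid A π B := by
      clear hfinal
      induction hreach with
      | refl => exact ⟨.nil A, by simp, by simp, by simp⟩
      | tail _ hstep ih => exact ih.step hB hd hπ hstep
    have hcard : st.M.card = Fintype.card R := by
      refine le_antisymm hst.form.card_le (not_lt.1 fun hlt => ?_)
      have hidx : Fintype.card C ≤ st.idx := by
        by_contra hidx
        have h := not_le.1 hidx
        rcases triSucceeds_or_triFails A (insert (π ⟨st.idx, h⟩) st.M) with ⟨col, row, hs⟩ | hf
        · exact hfinal _ (.accept st h col row hlt hs)
        · exact hfinal _ (.reject st h hlt hf)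
      obtain ⟨j, hj⟩ : ∃ j, j ∉ st.row := by
        by_contra! hall
        have := Finset.card_le_card (fun j _ => by simpa using hall j :
          (Finset.univ : Finset R) ⊆ st.row.toFinset)
        rw [List.toFinset_card_of_nodup hst.form.row_nodup, ← hst.form.card_eq,
          Finset.card_univ] at this
        omega
      exact hst.maximal _ (hst.form.slack_notMem hslack hj)
        ((π.symm (slack j)).2.trans_le hidx) (hst.form.peelable_insert_slack hslack hj)
    have hrow := hst.form.mem_row_of_card_eq hcard
    refine ⟨hst.form.isTriangularSet hrow, hst.form.isLowerTriangularForm hrow, fun b hb => ?_⟩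
    by_contra hbM
    have hle : st.idx ≤ (π.symm b : ℕ) := not_lt.1 fun hlt => hbM (hst.mem_of_basic b hb hlt)
    have hsub : (↑(insert b st.M) : Set C) ⊆ B := by
      intro i hi
      rcases Finset.mem_insert.1 (Finset.mem_coe.1 hi) with rfl | hi
      · exact hb
      · exact mem_basic_of_le hd hπ hb ((hst.lt_idx i hi).le.trans hle)
    have := (hB.mono hsub).card_le
    rw [Finset.card_insert_of_notMem (by simpa using hbM)] at this
    omega

end Incremental

/-! ### The row-wise greedy search -/

section RowWise

variable {R C : Type} [DecidableEq C] {A : Matrix R C ℝ} {d : C → ℝ} {B : Set C} {slack : R → C}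

/-- The residual matrix consists of the columns in some set `T`, no column in `B` has been erased,
and the selected rows and columns are in lower triangular form. -/
def RowState.IsValid (A : Matrix R C ℝ) (B : Set C) (st : RowState R C) : Prop :=
  ∃ T : Finset C, st.mat = restrictCols A T ∧ IsPeeling A T st.M st.col st.row ∧
    ∀ i ∈ B, i ∈ T ∨ i ∈ st.M

theorem RowState.IsValid.mem_of_mat_eq_zero (hB : Peelable A B) {st : RowState R C}
    (hst : st.IsValid A B) (h0 : st.mat = 0) {i : C} (hi : i ∈ B) : i ∈ st.M := by
  obtain ⟨T, hmat, hp, hBT⟩ := hst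
  refine (hBT i hi).resolve_left fun hiT => ?_
  -- Peelability of a singleton says that its column is nonzero, so it cannot remain in a zero
  -- residual matrix.
  obtain ⟨j, i', hji⟩ := hB {i} (by simp) (by simpa using hi)
  obtain ⟨hi', hne, -⟩ := isDegreeOne_restrictCols.1 hji
  rw [Finset.mem_singleton.1 hi'] at hne
  have := congrFun (congrFun (hmat.symm.trans h0) j) i
  simp [restrictCols, hiT, hne] at this

theorem RowState.IsValid.step (hslack : ∀ j k, A j (slack k) ≠ 0 ↔ j = k) (hB : Peelable A B)
    (hd : ∀ i ∈ B, ∀ k ∉ B, d k < d i) {st st' : RowState R C} (hst : st.IsValid A B)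
    (hstep : RowStep slack d st st') : st'.IsValid A B := by
  classical
  cases hstep with
  | select j i hji =>
    obtain ⟨T, hmat, hp, hBT⟩ := hst
    rw [hmat] at hji
    refine ⟨T.erase i, by simp only [hmat, updateCol_restrictCols], hp.select hji, ?_⟩
    intro i' hi'
    have := hBT i' hi'
    simp only [Finset.mem_erase, Finset.mem_insert]
    tauto
  | erase i hdeg hi hmin =>
    obtain ⟨T, hmat, hp, hBT⟩ := hst
    have hiB : i ∉ B := by
      intro hiB
      -- The weight is minimal only among nonzero residual columns, so zero columns of `T` are
      -- dropped first. If the minimum were in `B`, separation would put all of `T'` in `B`, and a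
      -- degree-one row would exist.
      let T' := T.filter fun i' => ∃ j, st.mat j i' ≠ 0
      have hT : ∀ i', (∃ j, st.mat j i' ≠ 0) → i' ∈ T := by
        rintro i' ⟨j, hj⟩
        by_contra hi'
        exact hj (by simp [hmat, restrictCols, hi'])
      have hT' : (T' : Set C) ⊆ B := by
        intro i' hi'
        by_contra hB'
        exact (hd i hiB i' hB').not_ge (hmin i' (Finset.mem_filter.1 (Finset.mem_coe.1 hi')).2)
      obtain ⟨j, i', hji⟩ := hB T' ⟨i, Finset.mem_filter.2 ⟨hT i hi, hi⟩⟩ hT'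
      refine hdeg j i' ?_
      have : st.mat = restrictCols A T' := by
        ext k l
        by_cases hl : ∃ j, st.mat j l ≠ 0
        · have hlT' : l ∈ T' := Finset.mem_filter.2 ⟨hT l hl, hl⟩
          simp [hmat, restrictCols, hT l hl, hlT']
        · have hlT' : l ∉ T' := fun h => hl (Finset.mem_filter.1 h).2
          push Not at hl
          simp [hl, restrictCols, hlT']
      rwa [this]
    refine ⟨T.erase i, by simp only [hmat, updateCol_restrictCols], ⟨hp.form, ?_, ?_⟩, ?_⟩
    · exact fun i' hi' => hp.notMem i' (Finset.mem_of_mem_erase hi')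
    · exact fun j hj i' hi' => hp.entry_eq_zero j hj i' (Finset.mem_of_mem_erase hi')
    · intro i' hi'
      refine (hBT i' hi').imp_left fun h => Finset.mem_erase.2 ⟨?_, h⟩
      rintro rfl
      exact hiB hi'
  | expand j h0 hj =>
    have hM := fun i hi => hst.mem_of_mat_eq_zero hB h0 (i := i) hi
    obtain ⟨T, hmat, hp, -⟩ := hst
    refine ⟨∅, ?_, ⟨hp.form.append hj (hp.form.slack_notMem hslack hj) (fun j' hj' => ?_)
      ((hslack j j).2 rfl), by simp, by simp⟩, fun i hi => Or.inr ?_⟩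
    · rw [h0]
      ext
      simp [restrictCols]
    · by_contra hne
      exact hj ((hslack j' j).1 hne ▸ hj')
    · exact Finset.mem_insert_of_mem (hM i hi)

theorem ncard_support_updateCol_lt [Finite C] {P : Matrix R C ℝ} {i : C} (hi : ∃ j, P j i ≠ 0) :
    {i' | ∃ j, P.updateCol i 0 j i' ≠ 0}.ncard < {i' | ∃ j, P j i' ≠ 0}.ncard := by
  refine Set.ncard_lt_ncard ?_
  refine (Set.ssubset_iff_of_subset ?_).2 ⟨i, hi, by simp⟩
  rintro i' ⟨j, hj⟩
  by_cases h : i' = i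
  · simp [h] at hj
  · exact ⟨j, by simpa [h] using hj⟩

/-- The number of nonzero columns plus the number of unrepresented rows strictly decreases. -/
theorem wellFounded_rowStep [Finite R] [Finite C] (slack : R → C) (d : C → ℝ) :
    WellFounded fun t s : RowState R C => RowStep slack d s t := by
  refine Subrelation.wf (r := InvImage (· < ·) fun st : RowState R C =>
    {i | ∃ j, st.mat j i ≠ 0}.ncard + {j | j ∉ st.row}.ncard) ?_ (InvImage.wf _ wellFounded_lt)
  intro t s hst
  simp only [InvImage]
  cases hst with
  | select j i hji =>
    refine add_lt_add_of_lt_of_le (ncard_support_updateCol_lt ⟨j, (hji i).2 rfl⟩)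
      (Set.ncard_le_ncard ?_)
    intro j'
    simp only [Set.mem_ofPred_eq, List.mem_append]
    tauto
  | erase i hdeg hi hmin => exact add_lt_add_left (ncard_support_updateCol_lt hi) _
  | expand j h0 hj =>
    refine add_lt_add_right (Set.ncard_lt_ncard ?_) _
    refine (Set.ssubset_iff_of_subset ?_).2 ⟨j, hj, by simp⟩
    intro j'
    simp only [Set.mem_ofPred_eq, List.mem_append]
    tauto

theorem rowWiseFinds_of_separated [Fintype R] [Fintype C]
    (hslack : ∀ j k, A j (slack k) ≠ 0 ↔ j = k)
    (hB : Peelable A B) (hd : ∀ i ∈ B, ∀ k ∉ B, d k < d i) : RowWiseFinds A slack d B := by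
  refine ⟨(wellFounded_rowStep slack d).apply _, fun st hreach hfinal => ?_⟩
  have hst : st.IsValid A B := by
    clear hfinal
    induction hreach with
    | refl => exact ⟨Finset.univ, by ext; simp [restrictCols], ⟨.nil A, by simp, by simp⟩, by simp⟩
    | tail _ hstep ih => exact ih.step hslack hB hd hstep
  have h0 : st.mat = 0 := by
    by_contra hne
    by_cases hdeg : ∃ j i, IsDegreeOne st.mat j i
    · obtain ⟨j, i, hji⟩ := hdeg
      exact hfinal _ (.select st j i hji)
    · push Not at hdeg
      obtain ⟨i, hi, hmin⟩ := Set.exists_min_image {i | ∃ j, st.mat j i ≠ 0} d (Set.toFinite _) (by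
        by_contra hemp
        refine hne (Matrix.ext fun j i => ?_)
        by_contra hji
        exact hemp ⟨i, j, hji⟩)
      exact hfinal _ (.erase st i hdeg hi hmin)
  have hrow : ∀ j, j ∈ st.row := fun j => by
    by_contra hj
    exact hfinal _ (.expand st j h0 hj)
  have hM : B ⊆ ↑st.M := fun i hi => hst.mem_of_mat_eq_zero hB h0 hi
  obtain ⟨T, -, hp, -⟩ := hst
  exact ⟨hp.form.isTriangularSet hrow, hp.form.isLowerTriangularForm hrow, hM⟩

end RowWise

/-! ### Linear programs with a unique solution -/

/-- The dual constraint map, the dual slacks being restricted to the columns where `x` vanishes. -/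
noncomputable def dualMap {R C : Type} [Fintype R] (A : Matrix R C ℝ) (x : C → ℝ) :
    (R → ℝ) × (C → ℝ) →ₗ[ℝ] (C → ℝ) :=
  Aᵀ.mulVecLin.coprod
    (LinearMap.pi fun i => (if x i = 0 then (1 : ℝ) else 0) • LinearMap.proj i)

theorem dualMap_apply {R C : Type} [Fintype R] {A : Matrix R C ℝ} {x : C → ℝ}
    (y : R → ℝ) (z : C → ℝ) :
    dualMap A x (y, z) = Aᵀ *ᵥ y + fun i => if x i = 0 then z i else 0 := by
  ext i
  by_cases h : x i = 0 <;> simp [dualMap, h, Matrix.mulVec_transpose]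

section LinearProgram

variable {R C : Type} [Fintype C] {A : Matrix R C ℝ} {b : R → ℝ} {c x : C → ℝ}

/-- `x` is the unique minimizer of `cᵀx` subject to `A x = b`, `x ≥ 0`. -/
def IsUniqueOptimum (A : Matrix R C ℝ) (b : R → ℝ) (c x : C → ℝ) : Prop :=
  IsPrimalFeasible A b x ∧ ∀ x', IsPrimalFeasible A b x' → c ⬝ᵥ x' ≤ c ⬝ᵥ x → x' = x

/-- A short step along `h` stays feasible and costs no more, so uniqueness makes it trivial. All
uses of uniqueness below, apart from the truncation argument, go through this. -/
theorem IsUniqueOptimum.eq_zero_of_direction (hx : IsUniqueOptimum A b c x) {h : C → ℝ}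
    (hA : A *ᵥ h = 0) (hpos : ∀ i, x i = 0 → 0 ≤ h i) (hc : c ⬝ᵥ h ≤ 0) : h = 0 := by
  have hev : ∀ i, ∀ᶠ ε : ℝ in nhdsWithin 0 (Set.Ioi 0), 0 ≤ x i + ε * h i := by
    intro i
    rcases (hx.1.2 i).eq_or_lt with h0 | hlt
    · filter_upwards [self_mem_nhdsWithin] with ε hε
      rw [← h0, zero_add]
      exact mul_nonneg (le_of_lt hε) (hpos i h0.symm)
    · have hcont : Continuous fun ε : ℝ => x i + ε * h i := by fun_prop
      have := (hcont.tendsto 0).eventually_const_lt (u := 0) (by simpa using hlt)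
      filter_upwards [nhdsWithin_le_nhds this] with ε hε using hε.le
  obtain ⟨ε, hε, hε0⟩ := ((Filter.eventually_all.2 hev).and self_mem_nhdsWithin).exists
  have hε0 : 0 < ε := hε0
  have := hx.2 (x + ε • h)
    ⟨by rw [Matrix.mulVec_add, Matrix.mulVec_smul, hA, smul_zero, add_zero, hx.1.1], hε⟩
    (by
      rw [dotProduct_add, dotProduct_smul, smul_eq_mul]
      nlinarith)
  have h0 : ε • h = 0 := by simpa using this
  exact (smul_eq_zero.1 h0).resolve_left hε0.ne'

variable [Fintype R]

theorem dotProduct_eq_of_dual {y : R → ℝ} {z x' : C → ℝ} (hz : Aᵀ *ᵥ y + z = c)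
    (hx' : A *ᵥ x' = b) : c ⬝ᵥ x' = b ⬝ᵥ y + x' ⬝ᵥ z := by
  rw [← hz, ← hx', add_dotProduct, Matrix.mulVec_transpose, ← Matrix.dotProduct_mulVec,
    dotProduct_comm y, dotProduct_comm z]

theorem dotProduct_transpose_mulVec (h : C → ℝ) (y : R → ℝ) :
    h ⬝ᵥ (Aᵀ *ᵥ y) = (A *ᵥ h) ⬝ᵥ y := by
  rw [Matrix.dotProduct_mulVec, Matrix.vecMul_transpose]

theorem isPrimalDualSolution_of_complementary {y : R → ℝ} {z : C → ℝ}
    (hx : IsPrimalFeasible A b x) (hz : IsDualFeasible A c y z) (h0 : x ⬝ᵥ z = 0) :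
    IsPrimalDualSolution A b c x y z := by
  have hxz := dotProduct_eq_of_dual hz.1 hx.1
  refine ⟨⟨hx, fun x' hx' => ?_⟩, hz, fun y' z' hz' => ?_⟩
  · have := dotProduct_eq_of_dual hz.1 hx'.1
    have hnn : 0 ≤ x' ⬝ᵥ z := Finset.sum_nonneg fun i _ => mul_nonneg (hx'.2 i) (hz.2 i)
    linarith
  · have := dotProduct_eq_of_dual hz'.1 hx.1
    have hnn : 0 ≤ x ⬝ᵥ z' := Finset.sum_nonneg fun i _ => mul_nonneg (hx.2 i) (hz'.2 i)
    linarith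

/-- A functional that kills the range is a vector `h` in the kernel of `A` vanishing wherever `x`
does. Both `h` and `-h` are then feasible directions, and one of them does not raise the cost.
Surjectivity makes `dualMap A x` an open map. -/
theorem IsUniqueOptimum.dualMap_surjective (hx : IsUniqueOptimum A b c x) :
    Function.Surjective (dualMap A x) := by
  classical
  rw [← LinearMap.range_eq_top]
  by_contra hne
  obtain ⟨f, hf, hker⟩ := Submodule.exists_le_ker_of_lt_top _ (lt_top_iff_ne_top.2 hne)
  obtain ⟨h, rfl⟩ := (dotProductEquiv ℝ C).surjective f
  have hzero : ∀ p, h ⬝ᵥ dualMap A x p = 0 := fun p => hker (LinearMap.mem_range_self _ p)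
  have hA : A *ᵥ h = 0 := by
    have := hzero (A *ᵥ h, 0)
    rw [dualMap_apply, dotProduct_add, dotProduct_transpose_mulVec] at this
    rw [← dotProduct_self_eq_zero]
    simpa [dotProduct] using this
  have hN : ∀ i, x i = 0 → h i = 0 := by
    intro i hi
    have := hzero (0, Pi.single i 1)
    have hs : (fun k => if x k = 0 then (Pi.single i 1 : C → ℝ) k else 0) = Pi.single i 1 := by
      ext k
      by_cases hk : k = i
      · simp [hk, hi]
      · simp [hk]
    rwa [dualMap_apply, hs, Matrix.mulVec_zero, zero_add, dotProduct_single, mul_one] at this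
  refine hf ((map_eq_zero_iff _ (dotProductEquiv ℝ C).injective).2 ?_)
  rcases le_total (c ⬝ᵥ h) 0 with hc | hc
  · exact hx.eq_zero_of_direction hA (fun i hi => (hN i hi).ge) hc
  · refine neg_eq_zero.1 (hx.eq_zero_of_direction (h := -h) ?_ (fun i hi => ?_) ?_)
    · rw [Matrix.mulVec_neg, hA, neg_zero]
    · simp [hN i hi]
    · rw [dotProduct_neg]
      linarith

/-- Strict complementarity amounts to `c` lying in the image of the open cone of positive `z`, which
is open and convex. Otherwise a strict separator `h` exists, and `-h` turns out to be a feasible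
direction that does not raise the cost; so `h = 0`, contradicting strictness. -/
theorem IsUniqueOptimum.exists_strictlyComplementary (hx : IsUniqueOptimum A b c x) :
    ∃ y z, IsPrimalDualSolution A b c x y z ∧ StrictlyComplementary x z := by
  classical
  let U : Set ((R → ℝ) × (C → ℝ)) := {p | ∀ i, 0 < p.2 i}
  have hUo : IsOpen U := by
    have : U = ⋂ i, {p | 0 < p.2 i} := by ext; simp [U]
    rw [this]
    exact isOpen_iInter_of_finite fun i => isOpen_lt continuous_const (by fun_prop)
  have hUc : Convex ℝ U := by
    intro p hp q hq s t hs ht hst i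
    have h1 := hp i
    have h2 := hq i
    simp only [Prod.snd_add, Prod.smul_snd, Pi.add_apply, Pi.smul_apply, smul_eq_mul]
    rcases hs.eq_or_lt with rfl | hs
    · have : t = 1 := by linarith
      simpa [this] using h2
    · exact add_pos_of_pos_of_nonneg (mul_pos hs h1) (mul_nonneg ht h2.le)
  have hmem : c ∈ dualMap A x '' U := by
    by_contra hc
    obtain ⟨f, hf⟩ := geometric_hahn_banach_open_point (hUc.linear_image (dualMap A x))
      (LinearMap.isOpenMap_of_finiteDimensional _ hx.dualMap_surjective U hUo) hc
    obtain ⟨h, hh⟩ := (dotProductEquiv ℝ C).surjective f.toLinearMap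
    have hfh : ∀ w, f w = h ⬝ᵥ w := fun w => (LinearMap.congr_fun hh w).symm
    have hlt : ∀ (y : R → ℝ) (z : C → ℝ), (∀ i, 0 < z i) →
        (A *ᵥ h) ⬝ᵥ y + h ⬝ᵥ (fun i => if x i = 0 then z i else 0) < h ⬝ᵥ c := by
      intro y z hz
      have := hf _ ⟨(y, z), hz, rfl⟩
      rwa [hfh, hfh, dualMap_apply, dotProduct_add, dotProduct_transpose_mulVec] at this
    have hA : A *ᵥ h = 0 := by
      by_contra hne
      have hpos : (A *ᵥ h) ⬝ᵥ (A *ᵥ h) ≠ 0 := fun h0 => hne (dotProduct_self_eq_zero.1 h0)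
      -- The multiple of `A *ᵥ h` is chosen to make the left side of `hlt` equal to its right side;
      -- the next two claims choose `z` in the same way.
      have := hlt (((h ⬝ᵥ c - h ⬝ᵥ (fun i => if x i = 0 then 1 else 0)) /
        ((A *ᵥ h) ⬝ᵥ (A *ᵥ h))) • (A *ᵥ h)) (fun _ => 1) (fun _ => one_pos)
      rw [dotProduct_smul, smul_eq_mul, div_mul_cancel₀ _ hpos] at this
      linarith
    simp only [hA, zero_dotProduct, zero_add] at hlt
    replace hlt := hlt 0
    have hN : ∀ i, x i = 0 → h i ≤ 0 := by
      intro i hi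
      by_contra! hpos
      have hlt1 := hlt (fun _ => 1) fun _ => one_pos
      set s := h ⬝ᵥ (fun i => if x i = 0 then 1 else 0) with hs
      have hts : (fun k => if x k = 0 then
          1 + (Pi.single i ((h ⬝ᵥ c - s) / h i) : C → ℝ) k else 0) =
          (fun k => if x k = 0 then (1 : ℝ) else 0) + Pi.single i ((h ⬝ᵥ c - s) / h i) := by
        ext k
        by_cases hk : k = i
        · simp [hk, hi]
        · simp [hk]
      have := hlt (fun k => 1 + (Pi.single i ((h ⬝ᵥ c - s) / h i) : C → ℝ) k) (fun k => by
        by_cases hk : k = i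
        · subst hk
          rw [Pi.single_eq_same]
          have := div_pos (sub_pos.2 hlt1) hpos
          linarith
        · simp [hk])
      rw [hts, dotProduct_add, dotProduct_single, mul_div_cancel₀ _ hpos.ne', ← hs] at this
      linarith
    have hc0 : 0 ≤ h ⬝ᵥ c := by
      by_contra! hneg
      have hlt1 := hlt (fun _ => 1) fun _ => one_pos
      set s := h ⬝ᵥ (fun i => if x i = 0 then 1 else 0) with hs
      have hsneg : s < 0 := hlt1.trans hneg
      -- Since `s < h ⬝ᵥ c < 0`, scaling the all-ones vector by their positive quotient attains
      -- equality.
      have := hlt (fun _ => h ⬝ᵥ c / s) fun _ => div_pos_of_neg_of_neg hneg hsneg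
      have hts : (fun k => if x k = 0 then h ⬝ᵥ c / s else 0) =
          (h ⬝ᵥ c / s) • (fun k => if x k = 0 then (1 : ℝ) else 0) := by
        ext k
        simp
      rw [hts, dotProduct_smul, ← hs, smul_eq_mul, div_mul_cancel₀ _ hsneg.ne] at this
      exact lt_irrefl _ this
    have h0 : -h = 0 := by
      refine hx.eq_zero_of_direction ?_ (fun i hi => ?_) ?_
      · rw [Matrix.mulVec_neg, hA, neg_zero]
      · simpa using hN i hi
      · rw [dotProduct_neg, dotProduct_comm]
        linarith
    have := hlt (fun _ => 1) fun _ => one_pos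
    simp [neg_eq_zero.1 h0] at this
  obtain ⟨⟨y, z⟩, hz, hyz⟩ := hmem
  rw [dualMap_apply] at hyz
  have hz : ∀ i, 0 < z i := hz
  refine ⟨y, _, isPrimalDualSolution_of_complementary hx.1 ⟨hyz, fun i => ?_⟩ ?_, fun i => ?_⟩
  · split_ifs
    exacts [(hz i).le, le_rfl]
  · refine Finset.sum_eq_zero fun i _ => ?_
    dsimp only
    split_ifs with h
    · rw [h, zero_mul]
    · rw [mul_zero]
  · rcases (hx.1.2 i).eq_or_lt with h | h
    · exact Or.inl ⟨h.symm, by simpa [← h] using hz i⟩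
    · exact Or.inr ⟨h, if_neg h.ne'⟩

end LinearProgram

/-! ### Separation of the weights -/

section Weights

variable {C : Type} {x z xs zs : C → ℝ}

theorem weight_lt_weight (hxz : IsInterior x z) {i k : C} (h : x k * z i < x i * z k) :
    weight x z k < weight x z i :=
  Real.sqrt_lt_sqrt (div_nonneg (hxz.1 k).le (hxz.2 k).le)
    ((div_lt_div_iff₀ (hxz.2 k) (hxz.2 i)).2 h)

theorem StrictlyComplementary.of_notMem_basicSet (h : StrictlyComplementary xs zs) {k : C}
    (hk : k ∉ basicSet xs) : xs k = 0 ∧ 0 < zs k :=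
  (h k).resolve_right fun h => hk h.1

theorem StrictlyComplementary.of_mem_basicSet (h : StrictlyComplementary xs zs) {i : C}
    (hi : i ∈ basicSet xs) : 0 < xs i ∧ zs i = 0 :=
  (h i).resolve_left fun h => (h.1 ▸ (show 0 < xs i from hi)).false

variable [Fintype C]

/-- Weights blow up at the limit point, so they are compared after cross-multiplying: there `zs i =
0`, while `xs i * zs k > 0`. -/
theorem exists_separated_near {R : Type} [Fintype R] (h : StrictlyComplementary xs zs)
    (ys : R → ℝ) : ∃ ε : ℝ, 0 < ε ∧ ∀ (x : C → ℝ) (y : R → ℝ) (z : C → ℝ), IsInterior x z →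
      dist (x, y, z) (xs, ys, zs) < ε →
      ∀ i ∈ basicSet xs, ∀ k ∉ basicSet xs, weight x z k < weight x z i := by
  have hev : ∀ᶠ p : (C → ℝ) × (R → ℝ) × (C → ℝ) in nhds (xs, ys, zs),
      ∀ i k, i ∈ basicSet xs → k ∉ basicSet xs → p.1 k * p.2.2 i < p.1 i * p.2.2 k := by
    refine Filter.eventually_all.2 fun i => Filter.eventually_all.2 fun k => ?_
    by_cases hi : i ∈ basicSet xs
    · by_cases hk : k ∈ basicSet xs
      · exact Filter.Eventually.of_forall fun p _ h => absurd hk h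
      · have hlt : xs k * zs i < xs i * zs k := by
          rw [(h.of_mem_basicSet hi).2, mul_zero]
          exact mul_pos hi (h.of_notMem_basicSet hk).2
        have hopen : IsOpen {p : (C → ℝ) × (R → ℝ) × (C → ℝ) |
            p.1 k * p.2.2 i < p.1 i * p.2.2 k} := isOpen_lt (by fun_prop) (by fun_prop)
        filter_upwards [hopen.mem_nhds hlt] with p hp _ _ using hp
    · exact Filter.Eventually.of_forall fun p h => absurd h hi
  obtain ⟨ε, hε, hsep⟩ := Metric.eventually_nhds_iff.1 hev
  exact ⟨ε, hε, fun x y z hxz hdist i hi k hk =>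
    weight_lt_weight hxz (hsep hdist i k hi hk)⟩

/-- This is orthogonality of `x - xs`, in the kernel of `A`, to `z - zs`, in its row space. -/
theorem dotProduct_add_dotProduct_eq {R : Type} [Fintype R] {A : Matrix R C ℝ} {b : R → ℝ}
    {c : C → ℝ} {y ys : R → ℝ} (hx : A *ᵥ x = b) (hxs : A *ᵥ xs = b) (hz : Aᵀ *ᵥ y + z = c)
    (hzs : Aᵀ *ᵥ ys + zs = c) : x ⬝ᵥ zs + xs ⬝ᵥ z = x ⬝ᵥ z + xs ⬝ᵥ zs := by
  have h1 := dotProduct_eq_of_dual hz hx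
  have h2 := dotProduct_eq_of_dual hz hxs
  have h3 := dotProduct_eq_of_dual hzs hx
  have h4 := dotProduct_eq_of_dual hzs hxs
  linarith

/-- Orthogonality bounds both `x k * zs k` and `xs i * z i` by `q * μ`. If the weights were in the
wrong order, centrality would give `θ * μ ≤ x k * z i`; multiplying out, `θ * (xs i * zs k) ≤ q ^ 2
* μ`, which fails for small `μ`. -/
theorem exists_separated_of_dualityMeasure_lt {R : Type} [Fintype R] {A : Matrix R C ℝ}
    {b : R → ℝ} {c : C → ℝ} {ys : R → ℝ} (hxs : IsPrimalFeasible A b xs)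
    (hzs : IsDualFeasible A c ys zs) (h : StrictlyComplementary xs zs) {θ : ℝ} (hθ : 0 < θ) :
    ∃ ε : ℝ, 0 < ε ∧ ∀ (x : C → ℝ) (y : R → ℝ) (z : C → ℝ), IsInterior x z →
      IsPrimalFeasible A b x → IsDualFeasible A c y z →
      (∀ i, θ * dualityMeasure x z ≤ x i * z i) → dualityMeasure x z < ε →
      ∀ i ∈ basicSet xs, ∀ k ∉ basicSet xs, weight x z k < weight x z i := by
  set q : ℝ := (Fintype.card C : ℝ) with hq
  have hev : ∀ᶠ ε : ℝ in nhdsWithin 0 (Set.Ioi 0),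
      ∀ i k, i ∈ basicSet xs → k ∉ basicSet xs → q ^ 2 * ε < θ * (xs i * zs k) := by
    refine nhdsWithin_le_nhds (Filter.eventually_all.2 fun i => Filter.eventually_all.2 fun k => ?_)
    by_cases hi : i ∈ basicSet xs
    · by_cases hk : k ∈ basicSet xs
      · exact Filter.Eventually.of_forall fun p _ h => absurd hk h
      · have hpos : 0 < θ * (xs i * zs k) := mul_pos hθ (mul_pos hi (h.of_notMem_basicSet hk).2)
        have hopen : IsOpen {ε : ℝ | q ^ 2 * ε < θ * (xs i * zs k)} :=
          isOpen_lt (by fun_prop) (by fun_prop)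
        filter_upwards [hopen.mem_nhds (x := 0) (by simpa using hpos)] with p hp _ _ using hp
    · exact Filter.Eventually.of_forall fun p h => absurd h hi
  obtain ⟨ε, hε, hε0⟩ := (hev.and self_mem_nhdsWithin).exists
  refine ⟨ε, hε0, fun x y z hxz hx hz hcent hμ i hi k hk => weight_lt_weight hxz ?_⟩
  set μ := dualityMeasure x z with hμdef
  have hqpos : 0 < q := by
    rw [hq]
    exact_mod_cast Fintype.card_pos_iff.2 ⟨i⟩
  have hqμ : x ⬝ᵥ z = q * μ := by
    rw [hμdef, dualityMeasure, mul_div_cancel₀ _ hqpos.ne']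
  have hμpos : 0 < μ :=
    div_pos (Finset.sum_pos (fun i _ => mul_pos (hxz.1 i) (hxz.2 i)) ⟨i, Finset.mem_univ i⟩) hqpos
  have hcompl : xs ⬝ᵥ zs = 0 := Finset.sum_eq_zero fun i _ => by
    rcases h i with h | h
    · rw [h.1, zero_mul]
    · rw [h.2, mul_zero]
  have hsum := dotProduct_add_dotProduct_eq hx.1 hxs.1 hz.1 hzs.1
  rw [hcompl, hqμ, add_zero] at hsum
  have hnn1 : ∀ l ∈ Finset.univ, 0 ≤ x l * zs l := fun l _ => mul_nonneg (hxz.1 l).le (hzs.2 l)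
  have hnn2 : ∀ l ∈ Finset.univ, 0 ≤ xs l * z l := fun l _ => mul_nonneg (hxs.2 l) (hxz.2 l).le
  have h1 : x k * zs k ≤ q * μ := by
    have := Finset.single_le_sum hnn1 (Finset.mem_univ k)
    have := Finset.sum_nonneg hnn2
    simp only [dotProduct] at hsum
    linarith
  have h2 : xs i * z i ≤ q * μ := by
    have := Finset.single_le_sum hnn2 (Finset.mem_univ i)
    have := Finset.sum_nonneg hnn1
    simp only [dotProduct] at hsum
    linarith
  by_contra! hle
  have hxi := hxz.1 i
  have hzi := hxz.2 i
  have hxk := hxz.1 k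
  have hzk := hxz.2 k
  have hlow : θ * μ ≤ x k * z i := by
    have hsq : (θ * μ) * (θ * μ) ≤ (x k * z i) * (x k * z i) := by
      calc (θ * μ) * (θ * μ) ≤ (x i * z i) * (x k * z k) :=
            mul_le_mul (hcent i) (hcent k) (mul_pos hθ hμpos).le (mul_pos hxi hzi).le
        _ = (x i * z k) * (x k * z i) := by ring
        _ ≤ (x k * z i) * (x k * z i) := mul_le_mul_of_nonneg_right hle (mul_pos hxk hzi).le
    exact nonneg_le_nonneg_of_sq_le_sq (mul_pos hxk hzi).le hsq
  have hprod : (x k * zs k) * (xs i * z i) ≤ (q * μ) * (q * μ) :=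
    mul_le_mul h1 h2 (hnn2 i (Finset.mem_univ i)) (mul_pos hqpos hμpos).le
  have hpos : 0 < xs i * zs k := mul_pos hi (h.of_notMem_basicSet hk).2
  have hup : (θ * μ) * (xs i * zs k) ≤ (q * μ) * (q * μ) :=
    (mul_le_mul_of_nonneg_right hlow hpos.le).trans ((le_of_eq (by ring)).trans hprod)
  have hfin : θ * (xs i * zs k) ≤ q ^ 2 * μ := by
    refine le_of_mul_le_mul_left ?_ hμpos
    calc μ * (θ * (xs i * zs k)) = (θ * μ) * (xs i * zs k) := by ring
      _ ≤ (q * μ) * (q * μ) := hup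
      _ = μ * (q ^ 2 * μ) := by ring
  have hlt := hε i k hi hk
  have : q ^ 2 * μ ≤ q ^ 2 * ε := mul_le_mul_of_nonneg_left hμ.le (sq_nonneg q)
  linarith

end Weights

/-! ### Programs with constraints of parity type -/

section Parity

/-- The coefficients are `1`, `-1` or `0`, and the right-hand side is one less than the number of
coefficients `1`: the constraint forbids the 0-1 vector whose ones are at these coefficients. -/
def IsParityType {R ι : Type} [Fintype ι] (a : Matrix R ι ℝ) (b : R → ℝ) : Prop :=
  (∀ j i, a j i = 1 ∨ a j i = -1 ∨ a j i = 0) ∧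
    ∀ j, b j = (∑ i, if a j i = 1 then (1 : ℝ) else 0) - 1

theorem IsParityType.term_nonneg {R ι : Type} [Fintype ι] {a : Matrix R ι ℝ} {b : R → ℝ}
    (hab : IsParityType a b) {j : R} {i : ι} {t : ℝ} (h0 : 0 ≤ t)
    (h1 : t ≤ 1) : 0 ≤ (if a j i = 1 then 1 else 0) - a j i * t := by
  rcases hab.1 j i with h | h | h <;> simp [h] <;> norm_num <;> assumption

variable {R ι : Type} [Fintype R] [Fintype ι] [DecidableEq R] {a : Matrix R ι ℝ} {b : R → ℝ}
  {c : ι → ℝ} {x : ι ⊕ R → ℝ}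

theorem fromCols_one_mulVec_apply (x : ι ⊕ R → ℝ) (j : R) :
    (Matrix.fromCols a 1 *ᵥ x) j = ∑ i, a j i * x (Sum.inl i) + x (Sum.inr j) := by
  simp [Matrix.mulVec, dotProduct, Matrix.one_apply]

/-- Inside the unit box each summand is the distance of one coordinate in the support from the
forbidden vector: `1 - t` for coefficient 1, `t` for coefficient -1. -/
theorem IsParityType.sum_eq (hab : IsParityType a b) (hx : Matrix.fromCols a 1 *ᵥ x = b) (j : R) :
    ∑ i, ((if a j i = 1 then 1 else 0) - a j i * x (Sum.inl i)) = 1 + x (Sum.inr j) := by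
  have h := congrFun hx j
  rw [fromCols_one_mulVec_apply, hab.2] at h
  rw [Finset.sum_sub_distrib]
  linarith

/-- The unique solution lies in the unit box, since truncating a feasible point to the unit box
preserves feasibility. -/
theorem IsUniqueOptimum.le_one (hab : IsParityType a b) (hc : ∀ i, 0 ≤ c i)
    (hx : IsUniqueOptimum (Matrix.fromCols a 1) b (Sum.elim c 0) x) (i : ι) :
    x (Sum.inl i) ≤ 1 := by
  let w : ι → ℝ := fun i => min (x (Sum.inl i)) 1
  let x' : ι ⊕ R → ℝ := Sum.elim w fun j => b j - ∑ i, a j i * w i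
  have hw0 : ∀ i, 0 ≤ w i := fun i => le_min (hx.1.2 _) zero_le_one
  have hfeas : IsPrimalFeasible (Matrix.fromCols a 1) b x' := by
    refine ⟨funext fun j => ?_, ?_⟩
    · rw [fromCols_one_mulVec_apply]
      simp [x']
    · rintro (i | j)
      · exact hw0 i
      · have key : 1 ≤ ∑ i, ((if a j i = 1 then 1 else 0) - a j i * w i) := by
          -- A coordinate with coefficient -1 that is at least 1 contributes 1 by itself after
          -- truncation. Without one, truncation changes no coordinate with coefficient -1, and
          -- lowering those with coefficient 1 only increases the sum.
          by_cases hex : ∃ i, a j i = -1 ∧ 1 ≤ x (Sum.inl i)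
          · obtain ⟨i, hai, hi⟩ := hex
            refine le_trans ?_ (Finset.single_le_sum
              (fun i _ => hab.term_nonneg (hw0 i) (min_le_right _ _)) (Finset.mem_univ i))
            simp only [hai, w, min_eq_right hi]
            norm_num
          · push Not at hex
            calc (1 : ℝ) ≤ 1 + x (Sum.inr j) := by linarith [hx.1.2 (Sum.inr j)]
              _ = ∑ i, ((if a j i = 1 then 1 else 0) - a j i * x (Sum.inl i)) :=
                (hab.sum_eq hx.1.1 j).symm
              _ ≤ _ := by
                refine Finset.sum_le_sum fun i _ => ?_
                have hle : w i ≤ x (Sum.inl i) := min_le_left _ _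
                rcases hab.1 j i with h | h | h
                · rw [h]
                  linarith
                · have : w i = x (Sum.inl i) := min_eq_left (hex i h).le
                  rw [this]
                · rw [h]
                  simp
        rw [Finset.sum_sub_distrib] at key
        simp only [x', Sum.elim_inr, hab.2 j]
        linarith
  have heq := hx.2 x' hfeas (by
    rw [← Sum.elim_comp_inl_inr x, sumElim_dotProduct_sumElim, sumElim_dotProduct_sumElim]
    simp only [zero_dotProduct, add_zero]
    exact Finset.sum_le_sum fun i _ => mul_le_mul_of_nonneg_left (min_le_left _ _) (hc i))
  rw [← heq]
  exact min_le_right _ _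

/-- Among the positive coordinates of a 0-1 point, an active constraint has at most one negative
coefficient. -/
theorem IsParityType.eq_of_active (hab : IsParityType a b)
    (hx : IsPrimalFeasible (Matrix.fromCols a 1) b x) (hle : ∀ i, x (Sum.inl i) ≤ 1) {j : R}
    (hj : x (Sum.inr j) = 0) {i i' : ι} (hi : x (Sum.inl i) = 1) (hi' : x (Sum.inl i') = 1)
    (hai : a j i = -1) (hai' : a j i' = -1) : i = i' := by
  classical
  by_contra hne
  have hsum := hab.sum_eq hx.1 j
  -- An active row has total distance 1, but `i` and `i'` would contribute 1 each.
  have hle := Finset.sum_le_sum_of_subset_of_nonneg (Finset.subset_univ {i, i'})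
    fun k _ _ => hab.term_nonneg (j := j) (i := k) (hx.2 (Sum.inl k)) (hle k)
  rw [hsum, hj, Finset.sum_pair hne, hai, hai', hi, hi'] at hle
  norm_num at hle

/-- At most one coefficient on `T` is -1. If there is one, some other entry is nonzero because the
row does not have degree one there, and this entry must be +1. -/
theorem IsParityType.sum_nonneg_of_active (hab : IsParityType a b)
    (hx : IsPrimalFeasible (Matrix.fromCols a 1) b x) (hle : ∀ i, x (Sum.inl i) ≤ 1) {j : R}
    (hj : x (Sum.inr j) = 0) {T : Finset ι} (hT : ∀ i ∈ T, x (Sum.inl i) = 1)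
    (hdeg : ∀ i ∈ T, a j i ≠ 0 → ∃ i' ∈ T, i' ≠ i ∧ a j i' ≠ 0) : 0 ≤ ∑ i ∈ T, a j i := by
  classical
  by_cases hneg : ∃ i ∈ T, a j i = -1
  · obtain ⟨i, hi, hai⟩ := hneg
    have hnn : ∀ k ∈ T.erase i, 0 ≤ a j k := by
      intro k hk
      rcases hab.1 j k with h | h | h
      · rw [h]
        exact zero_le_one
      · exact absurd (hab.eq_of_active hx hle hj (hT k (Finset.mem_of_mem_erase hk)) (hT i hi) h hai)
          (Finset.ne_of_mem_erase hk)
      · exact h.ge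
    obtain ⟨i', hi', hne, hai'⟩ := hdeg i hi (by rw [hai]; norm_num)
    have hi'T : i' ∈ T.erase i := Finset.mem_erase.2 ⟨hne, hi'⟩
    have h1 : a j i' = 1 := by
      rcases hab.1 j i' with h | h | h
      · exact h
      · have := hnn i' hi'T
        rw [h] at this
        norm_num at this
      · exact absurd h hai'
    have := Finset.single_le_sum hnn hi'T
    rw [← Finset.add_sum_erase T _ hi, hai]
    linarith
  · push Not at hneg
    refine Finset.sum_nonneg fun i hi => ?_
    rcases hab.1 j i with h | h | h
    · rw [h]
      exact zero_le_one
    · exact absurd h (hneg i hi)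
    · exact h.ge

/-- Lowering all variables of a set `T` of ones preserves feasibility unless an active row has
degree one in `T`. -/
theorem IsUniqueOptimum.exists_active_degree_one (hab : IsParityType a b) (hc : ∀ i, 0 ≤ c i)
    (hx : IsUniqueOptimum (Matrix.fromCols a 1) b (Sum.elim c 0) x) {T : Finset ι}
    (hne : T.Nonempty) (hT : ∀ i ∈ T, x (Sum.inl i) = 1) :
    ∃ j, x (Sum.inr j) = 0 ∧ ∃ i ∈ T, a j i ≠ 0 ∧ ∀ i' ∈ T, i' ≠ i → a j i' = 0 := by
  classical
  by_contra! hcon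
  -- The slack components are forced by `A *ᵥ h = 0`; only those of active rows need to be
  -- nonnegative.
  let h : ι ⊕ R → ℝ := Sum.elim (fun i => if i ∈ T then -1 else 0) fun j => ∑ i ∈ T, a j i
  have h0 : h = 0 := by
    refine hx.eq_zero_of_direction (funext fun j => ?_) ?_ ?_
    · rw [fromCols_one_mulVec_apply]
      simp [h]
    · rintro (i | j) hi
      · have : i ∉ T := fun hiT => by
          rw [hT i hiT] at hi
          exact one_ne_zero hi
        simp [h, this]
      · exact hab.sum_nonneg_of_active hx.1 (hx.le_one hab hc) hi hT (hcon j hi)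
    · simp only [h, sumElim_dotProduct_sumElim, zero_dotProduct, add_zero]
      refine Finset.sum_nonpos fun i _ => mul_nonpos_of_nonneg_of_nonpos (hc i) ?_
      dsimp only
      split_ifs <;> norm_num
  obtain ⟨i, hi⟩ := hne
  have := congrFun h0 (Sum.inl i)
  simp [h, hi] at this

theorem IsUniqueOptimum.peelable_basicSet [DecidableEq ι] (hab : IsParityType a b)
    (hc : ∀ i, 0 ≤ c i) (hx : IsUniqueOptimum (Matrix.fromCols a 1) b (Sum.elim c 0) x)
    (hone : ∀ i, 0 < x (Sum.inl i) → x (Sum.inl i) = 1) :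
    Peelable (Matrix.fromCols a 1) (basicSet x) := by
  intro T hT hTB
  -- If `T` has a non-slack column, an active row has degree one among these, and its own slack
  -- column, not being basic, is not in `T`. Otherwise `T` consists of columns of the identity.
  by_cases hne : (T.preimage Sum.inl Sum.inl_injective.injOn).Nonempty
  · obtain ⟨j, hj, i, hi, hai, h0⟩ := hx.exists_active_degree_one hab hc hne
      fun i hi => hone i (hTB (by simpa using hi))
    refine ⟨j, Sum.inl i, isDegreeOne_restrictCols.2 ⟨by simpa using hi, by simpa using hai, ?_⟩⟩
    rintro (i' | k) hi' hne'
    · simpa using h0 i' (by simpa using hi') (fun h => hne' (congrArg _ h))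
    · have hk : 0 < x (Sum.inr k) := hTB hi'
      have hjk : j ≠ k := by
        rintro rfl
        exact hk.ne' hj
      simp [hjk]
  · obtain ⟨i | j, hi⟩ := hT
    · exact absurd ⟨i, by simpa using hi⟩ hne
    · refine ⟨j, Sum.inr j, isDegreeOne_restrictCols.2 ⟨hi, by simp, ?_⟩⟩
      rintro (i' | k) hi' hne'
      · exact absurd ⟨i', by simpa using hi'⟩ hne
      · have hjk : j ≠ k := fun h => hne' (congrArg _ h.symm)
        simp [hjk]

end Parity

/-! ### The augmented form -/

section Augmented

variable {m n : ℕ} (H : Matrix (Fin m) (Fin n) (ZMod 2)) (γ : Fin n → ℝ)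
  (K : Finset (Fin m × Finset (Fin n)))

/-- Replacing `u i` by `1 - u i` complements a coordinate of the forbidden vector if it is in the
support of the row: its coefficient changes sign, and the right-hand side changes with the count of
coefficients 1. -/
theorem isParityType_aug :
    IsParityType (Matrix.of fun (κ : K) i => sgn γ i * coeff H κ.1 i) (augb H γ K) := by
  refine ⟨fun κ i => ?_, fun κ => ?_⟩
  · simp only [Matrix.of_apply, sgn, coeff]
    split_ifs <;> simp
  · have hcard : (κ.1.2.card : ℝ) = ∑ i, if i ∈ κ.1.2 then (1 : ℝ) else 0 := by simp
    rw [augb, rhs, hcard, sub_right_comm, ← Finset.sum_sub_distrib]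
    congr 1
    refine Finset.sum_congr rfl fun i _ => ?_
    simp only [Matrix.of_apply, sgn, coeff]
    split_ifs <;> norm_num at *

theorem augA_mulVec_augx (u : Fin n → ℝ) : augA H γ K *ᵥ augx H γ K u = augb H γ K := by
  funext κ
  rw [augA, fromCols_one_mulVec_apply]
  simp only [augx, augb, Sum.elim_inl, Sum.elim_inr, Matrix.of_apply]
  rw [add_sub_left_comm, ← Finset.sum_sub_distrib, sub_eq_add_neg, ← Finset.sum_neg_distrib]
  congr 1
  refine Finset.sum_congr rfl fun i _ => ?_
  simp only [sgn]
  split_ifs <;> ring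

variable {H γ K}

theorem isPrimalFeasible_augx_iff {u : Fin n → ℝ} :
    IsPrimalFeasible (augA H γ K) (augb H γ K) (augx H γ K u) ↔ IsFeasible H γ K u := by
  constructor
  · rintro ⟨-, h⟩
    refine ⟨fun κ hκ => ?_, fun i hi => ?_, fun i hi => ?_⟩
    · simpa [augx] using h (Sum.inr ⟨κ, hκ⟩)
    · simpa [augx, hi] using h (Sum.inl i)
    · simpa [augx, not_le.2 hi] using h (Sum.inl i)
  · rintro ⟨h1, h2, h3⟩
    refine ⟨augA_mulVec_augx H γ K u, ?_⟩
    rintro (i | κ)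
    · by_cases hi : 0 ≤ γ i
      · simpa [augx, hi] using h2 i hi
      · simpa [augx, hi] using h3 i (not_le.1 hi)
    · simpa [augx] using h1 κ.1 κ.2

/-- The equations determine the slacks from the other variables, so uniqueness carries over to the
augmented program. -/
theorem exists_eq_augx {x : Fin n ⊕ K → ℝ} (hx : augA H γ K *ᵥ x = augb H γ K) :
    ∃ u, augx H γ K u = x := by
  let u : Fin n → ℝ := fun i => if 0 ≤ γ i then x (Sum.inl i) else 1 - x (Sum.inl i)
  have hinl : ∀ i, augx H γ K u (Sum.inl i) = x (Sum.inl i) := by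
    intro i
    by_cases hi : 0 ≤ γ i <;> simp [augx, u, hi]
  refine ⟨u, funext ?_⟩
  rintro (i | κ)
  · exact hinl i
  · have h := congrFun ((augA_mulVec_augx H γ K u).trans hx.symm) κ
    rw [augA, fromCols_one_mulVec_apply, fromCols_one_mulVec_apply] at h
    simpa only [hinl, add_right_inj] using h

theorem augc_dotProduct_augx (u : Fin n → ℝ) :
    augc γ K ⬝ᵥ augx H γ K u = ∑ i, γ i * u i + ∑ i, if 0 ≤ γ i then 0 else -γ i := by
  rw [augc, augx, sumElim_dotProduct_sumElim, ← Pi.zero_def, zero_dotProduct, add_zero,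
    ← Finset.sum_add_distrib]
  refine Finset.sum_congr rfl fun i _ => ?_
  simp only [sgn]
  split_ifs <;> ring

theorem IsUniqueSolution.isUniqueOptimum_augx {u : Fin n → ℝ} (hu : IsUniqueSolution H γ K u) :
    IsUniqueOptimum (augA H γ K) (augb H γ K) (augc γ K) (augx H γ K u) := by
  refine ⟨isPrimalFeasible_augx_iff.2 hu.1.1, fun x' hx' hle => ?_⟩
  obtain ⟨v, rfl⟩ := exists_eq_augx hx'.1
  have hv := isPrimalFeasible_augx_iff.1 hx'
  rw [augc_dotProduct_augx, augc_dotProduct_augx, add_le_add_iff_right] at hle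
  rw [hu.2 v ⟨hv, fun w hw => hle.trans (hu.1.2 w hw)⟩]

theorem IsUniqueSolution.peelable_basicSet {u : Fin n → ℝ} (hu : IsUniqueSolution H γ K u)
    (hint : ∀ i, ∃ a : ℤ, u i = a) : Peelable (augA H γ K) (basicSet (augx H γ K u)) := by
  have hopt := hu.isUniqueOptimum_augx
  have hc : ∀ i, 0 ≤ sgn γ i * γ i := by
    intro i
    simp only [sgn]
    split_ifs with h <;> linarith
  have hle := hopt.le_one (isParityType_aug H γ K) hc
  refine hopt.peelable_basicSet (isParityType_aug H γ K) hc fun i hi => ?_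
  obtain ⟨a, ha⟩ : ∃ a : ℤ, augx H γ K u (Sum.inl i) = a := by
    obtain ⟨a, ha⟩ := hint i
    by_cases h : 0 ≤ γ i
    · exact ⟨a, by simp [augx, h, ha]⟩
    · exact ⟨1 - a, by simp [augx, h, ha]⟩
  have h1 := hle i
  rw [ha] at hi h1 ⊢
  have h0 : 0 < a := by exact_mod_cast hi
  have h2 : a ≤ 1 := by exact_mod_cast h1
  have : a = 1 := by omega
  simp [this]

theorem bothGreedyFind_of_separated {u : Fin n → ℝ} (hu : IsUniqueSolution H γ K u)
    (hint : ∀ i, ∃ a : ℤ, u i = a) {x z : Fin n ⊕ K → ℝ}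
    (hd : ∀ i ∈ basicSet (augx H γ K u), ∀ k ∉ basicSet (augx H γ K u),
      weight x z k < weight x z i) : BothGreedyFind H γ K u x z := by
  have hslack : ∀ j k, augA H γ K j (Sum.inr k) ≠ 0 ↔ j = k := fun j k => by
    simp [augA, Matrix.one_apply]
  exact ⟨incrementalFinds_of_separated hslack (hu.peelable_basicSet hint) hd,
    rowWiseFinds_of_separated hslack (hu.peelable_basicSet hint) hd⟩

end Augmented

end LPDecoding

theorem theorem5 {m n : ℕ} (var : LPDecoding.Variant) (H : Matrix (Fin m) (Fin n) (ZMod 2))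
    (γ : Fin n → ℝ) (K : Finset (Fin m × Finset (Fin n)))
    (hK : LPDecoding.IsSubproblem var H γ K)
    (u : Fin n → ℝ) (hu : LPDecoding.IsUniqueSolution H γ K u)
    (hint : ∀ i, ∃ a : ℤ, u i = a) :
    -- a strictly complementary primal-dual solution exists
    (∃ (y : K → ℝ) (z : Fin n ⊕ K → ℝ),
      LPDecoding.IsPrimalDualSolution (LPDecoding.augA H γ K) (LPDecoding.augb H γ K)
        (LPDecoding.augc γ K) (LPDecoding.augx H γ K u) y z ∧
      LPDecoding.StrictlyComplementary (LPDecoding.augx H γ K u) z) ∧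
    -- interior points near a strictly complementary primal-dual solution
    (∀ (ys : K → ℝ) (zs : Fin n ⊕ K → ℝ),
      LPDecoding.IsPrimalDualSolution (LPDecoding.augA H γ K) (LPDecoding.augb H γ K)
        (LPDecoding.augc γ K) (LPDecoding.augx H γ K u) ys zs →
      LPDecoding.StrictlyComplementary (LPDecoding.augx H γ K u) zs →
      ∃ ε : ℝ, 0 < ε ∧ ∀ (x : Fin n ⊕ K → ℝ) (y : K → ℝ) (z : Fin n ⊕ K → ℝ),
        LPDecoding.IsInterior x z →
        dist (x, y, z) (LPDecoding.augx H γ K u, ys, zs) < ε →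
        LPDecoding.BothGreedyFind H γ K u x z) ∧
    -- feasible interior points in a neighbourhood of the central path, with small `μ`
    (∀ θ : ℝ, 0 < θ → ∃ ε : ℝ, 0 < ε ∧ ∀ (x : Fin n ⊕ K → ℝ) (y : K → ℝ) (z : Fin n ⊕ K → ℝ),
      LPDecoding.IsInterior x z →
      LPDecoding.IsPrimalFeasible (LPDecoding.augA H γ K) (LPDecoding.augb H γ K) x →
      LPDecoding.IsDualFeasible (LPDecoding.augA H γ K) (LPDecoding.augc γ K) y z →
      (∀ i, θ * LPDecoding.dualityMeasure x z ≤ x i * z i) →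
      LPDecoding.dualityMeasure x z < ε →
      LPDecoding.BothGreedyFind H γ K u x z) := by
  have hopt := hu.isUniqueOptimum_augx
  refine ⟨hopt.exists_strictlyComplementary, fun ys zs _ hsc => ?_, fun θ hθ => ?_⟩
  · obtain ⟨ε, hε, h⟩ := LPDecoding.exists_separated_near hsc ys
    exact ⟨ε, hε, fun x y z hxz hdist =>
      LPDecoding.bothGreedyFind_of_separated hu hint (h x y z hxz hdist)⟩
  · obtain ⟨ys, zs, hpd, hsc⟩ := hopt.exists_strictlyComplementary
    obtain ⟨ε, hε, h⟩ :=
      LPDecoding.exists_separated_of_dualityMeasure_lt hpd.1.1 hpd.2.1 hsc hθ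
    exact ⟨ε, hε, fun x y z hxz hx hz hcent hμ =>
      LPDecoding.bothGreedyFind_of_separated hu hint (h x y z hxz hx hz hcent hμ)⟩
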